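/- Let $(\mathbf y_t)_{t\in\mathbb Z}$, $\mathbf y_t=(y_t^1,\dots,y_t^d)^\top$, be a (strictly) stationary $d$-dimensional Gaussian vector autoregressive process $\mathbf y_t=\sum_{m=1}^{p}\mathbf A_m\mathbf y_{t-m}+\boldsymbol\epsilon_t$, where the errors $\boldsymbol\epsilon_t$ are i.i.d. $N(\mathbf 0,\boldsymbol\Sigma)$ with $\boldsymbol\Sigma$ positive definite and $\boldsymbol\epsilon_t$ is independent of the past $(\mathbf y_s)_{s<t}$. Let $k^*$ be the true lag length, i.e. the largest $m$ with $\mathbf A_m\neq 0$ ($k^*=0$ if there is none). Fix $k\ge 0$ and a node $i\in\{1,\dots,d\}$. From observations $\mathbf y_1,\dots,\mathbf y_N$ form the lagged data matrix $\mathbf Z$ with $N-k$ rows and $(k+1)d$ columns, whose column $ld+m$ (for $0\le l\le k$, $1\le m\le d$) is $(y^m_{k-l+1},\dots,y^m_{N-l})^\top$, and put $\mathbf S=\mathbf Z^\top\mathbf Z$. Let $S=\{d+1,\dots,(k+1)d\}$ be the set of lagged columns. For a candidate set $\mathrm{mb}(i)\subseteq S$ with $p_i=|\mathrm{mb}(i)|$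 and $\mathrm{fa}(i)=\mathrm{mb}(i)\cup\{i\}$, the local fractional marginal pseudo-likelihood is $$p(\mathbf Z_i\mid\mathbf Z_{\mathrm{mb}(i)},k)=\pi^{-\frac{N-k-1}{2}}\,\frac{\Gamma\left(\frac{N-k+p_i}{2}\right)}{\Gamma\left(\frac{p_i+1}{2}\right)}\,(N-k)^{-\frac{2p_i+1}{2}}\left(\frac{|\mathbf S_{\mathrm{fa}(i)}|}{|\mathbf S_{\mathrm{mb}(i)}|}\right)^{-\frac{N-k-1}{2}},$$ where $\mathbf S_B$ is the submatrix of $\mathbf S$ with rows and columns in $B$, $|\cdot|$ applied to a matrix is the determinant, and $|\mathbf S_\emptyset|=1$. The true temporal Markov blanket (parent set) $\mathrm{mb}(i)^*$ of $i$ is the set of lagged variables $y^a_{t-u}$, $u\ge1$, that are not conditionally independent of $y^i_t$ given all the other variables $y^c_s$, $s<t$, of the history before time $t$; the variable $y^a_{t-u}$ is identified with column $ud+a$. Suppose that $\mathrm{mb}(i)^*\subseteq S$ or $k\ge k^*$. Then $$\operatorname*{plim}_{N\to\infty}\ \operatorname*{arg\,max}_{\mathrm{mb}(i)\subseteq S}\,p(\mathbf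 Z_i\mid\mathbf Z_{\mathrm{mb}(i)},k)=\mathrm{mb}(i)^*,$$ that is, the probability that $\mathrm{mb}(i)^*$ is the unique maximiser of the score over all subsets of $S$ tends to $1$ as $N\to\infty$. -/

import Mathlib

open MeasureTheory ProbabilityTheory Filter Topology
open scoped Matrix ENNReal

namespace PLVAR

noncomputable section

variable {Ω : Type*} [MeasurableSpace Ω] {d : ℕ}

/-- `Y` is a stationary `d`-dimensional Gaussian VAR process on `ℤ` driven by the errors `ε`, with
lag matrices `A 1, …, A p` (the values of `A` outside `{1, …, p}` play no role):
`Y t = ∑ m = 1..p, A m * Y (t - m) + ε t`, where the errors are i.i.d. `N(0, Sig)` with `Sig`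
positive definite, and the error at time `t` is independent of the past of the process. -/
structure IsGaussianVAR (P : Measure Ω) (p : ℕ) (A : ℕ → Matrix (Fin d) (Fin d) ℝ)
    (Sig : Matrix (Fin d) (Fin d) ℝ) (Y ε : ℤ → Ω → EuclideanSpace ℝ (Fin d)) : Prop where
  posDef : Sig.PosDef
  measurable_Y : ∀ t, Measurable (Y t)
  measurable_err : ∀ t, Measurable (ε t)
  iIndep_err : iIndepFun ε P
  law_err : ∀ t, P.map (ε t) = multivariateGaussian 0 Sig
  indep_past : ∀ t, IndepFun (ε t) (fun ω (s : Set.Iio t) => Y s ω) P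
  recursion : ∀ t, ∀ᵐ ω ∂P, ∀ b : Fin d,
    Y t ω b = (∑ m ∈ Finset.Icc 1 p, ∑ a, A m b a * Y (t - m) ω a) + ε t ω b
  stationary : ∀ h : ℤ, IdentDistrib (fun ω t => Y (t + h) ω) (fun ω t => Y t ω) P P

open Classical in
/-- The true lag length: the largest `m ∈ {1, …, p}` with `A m ≠ 0` (and `0` if there is none). -/
def trueLagLength (p : ℕ) (A : ℕ → Matrix (Fin d) (Fin d) ℝ) : ℕ :=
  ((Finset.Icc 1 p).filter fun m => A m ≠ 0).sup id

/-- Conditional independence of the real random variables `X` and `W` given the σ-algebra `G`: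
`P(X ∈ B, W ∈ C | G) = P(X ∈ B | G) P(W ∈ C | G)` almost surely for all Borel sets `B`, `C`.
(Mathlib's `CondIndepFun` is the same property, on standard Borel sample spaces only.) -/
def CondIndepGiven (P : Measure Ω) (G : MeasurableSpace Ω) (X W : Ω → ℝ) : Prop :=
  ∀ B C : Set ℝ, MeasurableSet B → MeasurableSet C →
    P⟦X ⁻¹' B ∩ W ⁻¹' C | G⟧ =ᵐ[P] P⟦X ⁻¹' B | G⟧ * P⟦W ⁻¹' C | G⟧

/-- The σ-algebra generated by all the variables `Y_s^c`, `s < t`, of the history of the process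
before time `t`, except for the single variable `v = (c₀, s₀)`. -/
abbrev historyWithout (Y : ℤ → Ω → EuclideanSpace ℝ (Fin d)) (t : ℤ) (v : Fin d × ℤ) :
    MeasurableSpace Ω :=
  ⨆ w ∈ {w : Fin d × ℤ | w.2 < t ∧ w ≠ v},
    MeasurableSpace.comap (fun ω => Y w.2 ω w.1) inferInstance

/-- The directed edges `v → w` of the time series chain graph of `Y`: there is an edge
`(a, s) → (b, t)` iff `s < t` and `Y_s^a`, `Y_t^b` are not conditionally independent given the rest
of the history of the process before time `t`. -/
def DirectedEdge (P : Measure Ω) (Y : ℤ → Ω → EuclideanSpace ℝ (Fin d)) (v w : Fin d × ℤ) : Prop :=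
  v.2 < w.2 ∧ ¬ CondIndepGiven P (historyWithout Y w.2 v)
    (fun ω => Y v.2 ω v.1) (fun ω => Y w.2 ω w.1)

/-- The true temporal Markov blanket (parent set) of node `i`, with respect to the reference time
step `t`. Here `(l, a)` stands for series `a` at lag `l`, that is, for column `l * d + a` of the
lagged data matrix. -/
def temporalMarkovBlanket (P : Measure Ω) (Y : ℤ → Ω → EuclideanSpace ℝ (Fin d)) (t : ℤ)
    (i : Fin d) : Set (ℕ × Fin d) :=
  {v | DirectedEdge P Y (v.2, t - v.1) (i, t)}

/-- The candidate nodes: all the variables at lags `1, …, k`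
(columns `d + 1, …, (k + 1) * d` of the lagged data matrix). -/
def laggedNodes (d k : ℕ) : Finset (ℕ × Fin d) :=
  Finset.Icc 1 k ×ˢ Finset.univ

/-- The lagged data matrix built from the observations `y 1, …, y N`: it has `N - k` rows, and its
column `(l, a)` is `(y_{k-l+1}^a, …, y_{N-l}^a)`. Only the columns with `l ≤ k` are used. -/
def laggedData (y : ℤ → EuclideanSpace ℝ (Fin d)) (N k : ℕ) :
    Matrix (Fin (N - k)) (ℕ × Fin d) ℝ :=
  Matrix.of fun n v => y ((k : ℤ) - v.1 + 1 + n) v.2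

/-- The determinant of the submatrix of `Zᵀ * Z` restricted to the columns in `s`. -/
def scatterDet {n : ℕ} (Z : Matrix (Fin n) (ℕ × Fin d) ℝ) (s : Finset (ℕ × Fin d)) : ℝ :=
  ((Zᵀ * Z).submatrix (fun v : s => (v : ℕ × Fin d)) (fun v : s => (v : ℕ × Fin d))).det

/-- The local fractional marginal pseudo-likelihood `p(Z_i | Z_mb, k)`; the family of node `i` is
`mb` together with `i` itself, which is the variable `(0, i)`. -/
def localFMPL (y : ℤ → EuclideanSpace ℝ (Fin d)) (N k : ℕ) (i : Fin d)
    (mb : Finset (ℕ × Fin d)) : ℝ :=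
  Real.pi ^ (-((N : ℝ) - k - 1) / 2)
    * (Real.Gamma (((N : ℝ) - k + mb.card) / 2) / Real.Gamma (((mb.card : ℝ) + 1) / 2))
    * ((N : ℝ) - k) ^ (-(2 * (mb.card : ℝ) + 1) / 2)
    * (scatterDet (laggedData y N k) (insert (0, i) mb) / scatterDet (laggedData y N k) mb)
        ^ (-((N : ℝ) - k - 1) / 2)

/-- The set of all maximisers of the local score over the candidate sets `mb ⊆ S`. -/
def argmaxLocalFMPL (y : ℤ → EuclideanSpace ℝ (Fin d)) (N k : ℕ) (i : Fin d) :
    Set (Finset (ℕ × Fin d)) :=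
  {mb | mb ⊆ laggedNodes d k ∧
    ∀ mb' ⊆ laggedNodes d k, localFMPL y N k i mb' ≤ localFMPL y N k i mb}

end

end PLVAR

/-! The theorem combines an identification of the blanket with a BIC-type comparison of scores.

Identification. Write `Y_t^i` as its innovation plus the sum of `A_m(i,b) Y_{t-m}^b`. Given all
other variables before `t`, the variable `Y_{t-l}^a` keeps a nondegenerate Gaussian component `V`,
independent of that conditioning history and of the innovation. It enters `Y_t^i` with a coefficient
proportional to `A_l(i,a)`, so conditional independence holds iff `A_l(i,a) = 0`
(`condIndepGiven_iff`). The blanket is thus the support of row `i` of the lag matrices, and either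
alternative in the hypothesis says that this row has no nonzero entry beyond lag `k`.

Gaussianity. No stability of the lag matrices is assumed and the joint law is not given.
Substituting the recursion repeatedly factors characteristic functions; stationarity and positive
definite noise force the resulting variances to be summable, so finite linear combinations of the
process are centred Gaussian (`isGaussianProcess`).

Comparison. With `n = N - k` rows, the determinant ratio is the residual sum of squares `R` of the
least squares regression on `mb`. If a true parent is missing, `R` exceeds that of the true set by a
fixed factor, which costs the score an amount linear in `n` on the log scale. If `mb` strictly
contains the true set, `n (log R' - log R)`, with `R'` the residual of the true set, is at most a
small multiple of `log n`, whereas each superfluous parent costs a net `(log n) / 2`: the power of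
`n` takes `log n` and the Gamma factor returns half of it.

Both bounds on `R` (`residual_bounds`) need the regressors to be nearly orthogonal to the
innovations and the design to be well conditioned. The second comes from dual variables built from
innovations (`dualVar`), whose empirical products with the columns converge to the identity matrix.
Hence only averages of products with an innovation factor need laws of large numbers, and no ergodic
theorem for products of the process with itself enters. -/

namespace PLVAR

/-! ### Convergence in probability as a filter, and second moment bounds. -/

variable {Ω : Type*} [MeasurableSpace Ω]

/-- The sets of pairs `(n, ω)` whose sections have probability tending to one. Convergence in
probability of a sequence is convergence along this filter. -/
def probFilter (P : Measure Ω) : Filter (ℕ × Ω) where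
  sets := {S | Tendsto (fun n => P {ω | (n, ω) ∉ S}) atTop (𝓝 0)}
  univ_sets := by simp
  sets_of_superset {S T} hS hST := by
    refine tendsto_of_tendsto_of_tendsto_of_le_of_le tendsto_const_nhds hS (fun _ => zero_le) ?_
    exact fun n => measure_mono fun ω h h' => h (hST h')
  inter_sets {S T} hS hT := by
    have h : Tendsto (fun n => P {ω | (n, ω) ∉ S} + P {ω | (n, ω) ∉ T}) atTop (𝓝 0) := by
      simpa using Tendsto.add hS hT
    refine tendsto_of_tendsto_of_tendsto_of_le_of_le tendsto_const_nhds h (fun _ => zero_le) ?_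
    intro n
    refine (measure_mono ?_).trans (measure_union_le _ _)
    intro ω hω
    by_contra hc
    simp only [Set.mem_union, Set.mem_ofPred_eq, not_or, not_not] at hc
    exact hω hc

lemma eventually_probFilter {P : Measure Ω} {Q : ℕ × Ω → Prop} :
    (∀ᶠ q in probFilter P, Q q) ↔ Tendsto (fun n => P {ω | ¬ Q (n, ω)}) atTop (𝓝 0) := Iff.rfl

/-- This transports deterministic asymptotics in `n` to `probFilter`, where they can be intersected
with random events. -/
lemma tendsto_fst_probFilter (P : Measure Ω) : Tendsto Prod.fst (probFilter P) atTop := by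
  intro S hS
  change Tendsto (fun n => P {ω | (n, ω) ∉ Prod.fst ⁻¹' S}) atTop (𝓝 0)
  refine tendsto_const_nhds.congr' ?_
  filter_upwards [hS] with n hn
  simp [hn]

/-- Events of probability tending to one, as measures of possibly non-measurable sets. -/
lemma tendsto_measure_one_of_eventually {P : Measure Ω} [IsProbabilityMeasure P] {Q : ℕ × Ω → Prop}
    (h : ∀ᶠ q in probFilter P, Q q) : Tendsto (fun n => P {ω | Q (n, ω)}) atTop (𝓝 1) := by
  rw [eventually_probFilter] at h
  have h1 : Tendsto (fun n => 1 - P {ω | ¬ Q (n, ω)}) atTop (𝓝 (1 - 0)) :=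
    ENNReal.Tendsto.sub tendsto_const_nhds h (Or.inl ENNReal.one_ne_top)
  rw [tsub_zero] at h1
  refine tendsto_of_tendsto_of_tendsto_of_le_of_le h1 tendsto_const_nhds (fun n => ?_)
    (fun n => prob_le_one)
  rw [tsub_le_iff_right, ← measure_univ (μ := P)]
  refine (measure_mono ?_).trans (measure_union_le _ _)
  intro ω _
  exact em _

lemma tendsto_probFilter_of_ae {P : Measure Ω} [IsFiniteMeasure P] {f : ℕ → Ω → ℝ} {c : ℝ}
    (hf : ∀ n, AEStronglyMeasurable (f n) P)
    (h : ∀ᵐ ω ∂P, Tendsto (fun n => f n ω) atTop (𝓝 c)) :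
    Tendsto (fun q : ℕ × Ω => f q.1 q.2) (probFilter P) (𝓝 c) := by
  have h1 := tendstoInMeasure_of_tendsto_ae hf h
  rw [EMetric.tendsto_nhds]
  intro ε hε
  rw [eventually_probFilter]
  refine (h1 ε hε).congr fun n => ?_
  simp only [not_lt]

/-- Chebyshev's inequality as a criterion for convergence to `0` in probability. -/
lemma tendsto_probFilter_zero_of_sq {P : Measure Ω} [IsFiniteMeasure P] {f : ℕ → Ω → ℝ}
    {b : ℕ → ℝ} (hf : ∀ n, Integrable (fun ω => f n ω ^ 2) P)
    (hb : ∀ n, ∫ ω, f n ω ^ 2 ∂P ≤ b n) (h0 : Tendsto b atTop (𝓝 0)) :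
    Tendsto (fun q : ℕ × Ω => f q.1 q.2) (probFilter P) (𝓝 0) := by
  rw [Metric.tendsto_nhds]
  intro ε hε
  rw [eventually_probFilter]
  have h1 : Tendsto (fun n => ENNReal.ofReal (b n / ε ^ 2)) atTop (𝓝 0) := by
    have := ENNReal.tendsto_ofReal (h0.div_const (ε ^ 2))
    simpa using this
  refine tendsto_of_tendsto_of_tendsto_of_le_of_le tendsto_const_nhds h1 (fun _ => zero_le) ?_
  intro n
  have h2 := mul_meas_ge_le_integral_of_nonneg (ae_of_all P fun ω => sq_nonneg (f n ω)) (hf n)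
    (ε ^ 2)
  have h3 : {ω | ¬ dist (f n ω) 0 < ε} ⊆ {ω | ε ^ 2 ≤ f n ω ^ 2} := by
    intro ω hω
    simp only [Set.mem_ofPred_eq, not_lt, dist_zero_right, Real.norm_eq_abs] at hω
    simpa using pow_le_pow_left₀ hε.le hω 2
  refine (measure_mono h3).trans ?_
  rw [← ENNReal.ofReal_toReal (measure_ne_top P {ω | ε ^ 2 ≤ f n ω ^ 2})]
  refine ENNReal.ofReal_le_ofReal ?_
  rw [le_div_iff₀ (by positivity), mul_comm]
  exact h2.trans (hb n)

/-- Orthogonal sequences with constant second moments: second moments of partial sums. -/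
lemma integral_sq_sum_of_orthogonal {P : Measure Ω} {ξ : ℕ → Ω → ℝ} {C : ℝ}
    (hL : ∀ j, MemLp (ξ j) 2 P) (hC : ∀ j, ∫ ω, ξ j ω ^ 2 ∂P = C)
    (ho : ∀ i j, i < j → ∫ ω, ξ i ω * ξ j ω ∂P = 0) (n : ℕ) :
    Integrable (fun ω => (∑ j ∈ Finset.range n, ξ j ω) ^ 2) P ∧
      ∫ ω, (∑ j ∈ Finset.range n, ξ j ω) ^ 2 ∂P = n * C := by
  have hint : ∀ n, MemLp (fun ω => ∑ j ∈ Finset.range n, ξ j ω) 2 P :=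
    fun n => memLp_finsetSum _ fun j _ => hL j
  refine ⟨(hint n).integrable_sq, ?_⟩
  induction n with
  | zero => simp
  | succ n ih =>
    have hij : ∀ j, Integrable (fun ω => ξ j ω * ξ n ω) P := fun j => (hL j).integrable_mul (hL n)
    have hc : ∫ ω, (∑ j ∈ Finset.range n, ξ j ω) * ξ n ω ∂P = 0 := by
      simp_rw [Finset.sum_mul]
      rw [integral_finsetSum _ fun j _ => hij j]
      exact Finset.sum_eq_zero fun j hj => ho j n (Finset.mem_range.1 hj)
    have hi : Integrable (fun ω => (∑ j ∈ Finset.range n, ξ j ω) * ξ n ω) P :=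
      (hint n).integrable_mul (hL n)
    have hs : Integrable (fun ω => (∑ j ∈ Finset.range n, ξ j ω) ^ 2 + ξ n ω ^ 2) P :=
      (hint n).integrable_sq.add (hL n).integrable_sq
    have : ∀ ω, (∑ j ∈ Finset.range (n + 1), ξ j ω) ^ 2 =
        ((∑ j ∈ Finset.range n, ξ j ω) ^ 2 + ξ n ω ^ 2) +
          2 * ((∑ j ∈ Finset.range n, ξ j ω) * ξ n ω) := by
      intro ω
      rw [Finset.sum_range_succ]; ring
    simp_rw [this]
    rw [integral_add hs (hi.const_mul 2),
      integral_add (hint n).integrable_sq (hL n).integrable_sq, ih, hC, integral_const_mul, hc]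
    push_cast
    ring

end PLVAR

/-! ### Innovations: independence of the past, moments and characteristic function. -/

namespace PLVAR

variable {Ω : Type*} {d : ℕ}

/-- The innovations of a vector autoregression, as functions of the process itself. -/
def innov (p : ℕ) (A : ℕ → Matrix (Fin d) (Fin d) ℝ) (Y : ℤ → Ω → EuclideanSpace ℝ (Fin d))
    (t : ℤ) (b : Fin d) (ω : Ω) : ℝ :=
  Y t ω b - ∑ m ∈ Finset.Icc 1 p, ∑ a, A m b a * Y (t - m) ω a

/-- The σ-algebra generated by the history of the process before time `t`. -/
abbrev past (Y : ℤ → Ω → EuclideanSpace ℝ (Fin d)) (t : ℤ) : MeasurableSpace Ω :=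
  ⨆ w ∈ {w : Fin d × ℤ | w.2 < t}, MeasurableSpace.comap (fun ω => Y w.2 ω w.1) inferInstance

section Past

variable {Y : ℤ → Ω → EuclideanSpace ℝ (Fin d)}

lemma measurable_past {s t : ℤ} (h : s < t) (b : Fin d) :
    Measurable[past Y t] (fun ω => Y s ω b) := by
  refine Measurable.mono (comap_measurable _) ?_ le_rfl
  exact le_iSup₂ (f := fun (w : Fin d × ℤ) (_ : w ∈ {w : Fin d × ℤ | w.2 < t}) =>
    MeasurableSpace.comap (fun ω => Y w.2 ω w.1) inferInstance) (b, s) h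

lemma historyWithout_le_past (t : ℤ) (v : Fin d × ℤ) : historyWithout Y t v ≤ past Y t :=
  biSup_mono fun _ hw => hw.1

lemma measurable_historyWithout {t : ℤ} {v : Fin d × ℤ} {s : ℤ} {b : Fin d} (h : s < t)
    (hv : (b, s) ≠ v) : Measurable[historyWithout Y t v] (fun ω => Y s ω b) := by
  refine Measurable.mono (comap_measurable _) ?_ le_rfl
  exact le_iSup₂ (f := fun (w : Fin d × ℤ) (_ : w ∈ {w : Fin d × ℤ | w.2 < t ∧ w ≠ v}) =>
    MeasurableSpace.comap (fun ω => Y w.2 ω w.1) inferInstance) (b, s) ⟨h, hv⟩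

lemma measurable_past_innov {p : ℕ} {A : ℕ → Matrix (Fin d) (Fin d) ℝ} {s t : ℤ} (h : s < t)
    (b : Fin d) : Measurable[past Y t] (innov p A Y s b) := by
  unfold innov
  refine Measurable.sub (measurable_past h b) ?_
  refine Finset.measurable_sum _ fun m _ => Finset.measurable_sum _ fun a _ => ?_
  exact (measurable_past (by omega) a).const_mul _

variable [MeasurableSpace Ω]

lemma past_le (hY : ∀ t, Measurable (Y t)) (t : ℤ) : past Y t ≤ ‹MeasurableSpace Ω› := by
  refine iSup₂_le fun w _ => Measurable.comap_le ?_
  have := hY w.2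
  fun_prop

lemma measurable_innov {p : ℕ} {A : ℕ → Matrix (Fin d) (Fin d) ℝ} (hY : ∀ t, Measurable (Y t))
    (t : ℤ) (b : Fin d) : Measurable (innov p A Y t b) := by
  unfold innov
  fun_prop

end Past

variable [MeasurableSpace Ω]

namespace IsGaussianVAR

variable {P : Measure Ω} {p : ℕ} {A : ℕ → Matrix (Fin d) (Fin d) ℝ}
  {Sig : Matrix (Fin d) (Fin d) ℝ} {Y ε : ℤ → Ω → EuclideanSpace ℝ (Fin d)}

/-- The recursion for the errors holds only almost surely. Replacing them by `innov` makes the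
autoregressive equation an identity at every `ω` and makes each innovation measurable with respect
to the past of every later time. -/
lemma innov_ae_eq (hY : IsGaussianVAR P p A Sig Y ε) (t : ℤ) :
    (fun ω b => innov p A Y t b ω) =ᵐ[P] fun ω => (ε t ω).ofLp := by
  filter_upwards [hY.recursion t] with ω hω
  funext b
  simp only [innov, hω b]
  ring

lemma indepFun_innov [IsProbabilityMeasure P] (hY : IsGaussianVAR P p A Sig Y ε) (t : ℤ)
    {β γ : Type*} [MeasurableSpace β] [MeasurableSpace γ] {f : (Fin d → ℝ) → β} {g : Ω → γ}
    (hf : Measurable f) (hg : Measurable[past Y t] g) :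
    IndepFun (fun ω => f fun b => innov p A Y t b ω) g P := by
  have h1 : IndepFun (fun ω b => innov p A Y t b ω) (fun ω (s : Set.Iio t) => Y s ω) P := by
    have := (hY.indep_past t).comp (φ := fun x => x.ofLp) (by fun_prop) measurable_id
    exact this.congr (hY.innov_ae_eq t).symm (ae_eq_refl _)
  have h2 : past Y t ≤ MeasurableSpace.comap (fun ω (s : Set.Iio t) => Y s ω) inferInstance := by
    refine iSup₂_le fun w hw => ?_
    have : Measurable (fun x : Set.Iio t → EuclideanSpace ℝ (Fin d) => x ⟨w.2, hw⟩ w.1) := by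
      fun_prop
    exact (this.comp (comap_measurable (fun ω (s : Set.Iio t) => Y s ω))).comap_le
  have h3 := (IndepFun_iff_Indep _ _ _).1 h1
  rw [IndepFun_iff_Indep]
  refine indep_of_indep_of_le_left (indep_of_indep_of_le_right h3 ?_) ?_
  · exact hg.comap_le.trans h2
  · exact (hf.comp (comap_measurable (fun ω b => innov p A Y t b ω))).comap_le

lemma map_innov [IsProbabilityMeasure P] (hY : IsGaussianVAR P p A Sig Y ε) (t : ℤ) :
    P.map (fun ω b => innov p A Y t b ω) =
      (multivariateGaussian 0 Sig).map (fun x => x.ofLp) := by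
  rw [Measure.map_congr (hY.innov_ae_eq t), ← hY.law_err t, Measure.map_map (by fun_prop)
    (hY.measurable_err t)]
  rfl

lemma integral_innov_comp [IsProbabilityMeasure P] (hY : IsGaussianVAR P p A Sig Y ε) (t : ℤ)
    {E : Type*} [NormedAddCommGroup E] [NormedSpace ℝ E] {f : (Fin d → ℝ) → E}
    (hf : StronglyMeasurable f) :
    ∫ ω, f (fun b => innov p A Y t b ω) ∂P = ∫ x, f x.ofLp ∂(multivariateGaussian 0 Sig) := by
  have hm : Measurable (fun ω b => innov p A Y t b ω) :=
    measurable_pi_lambda _ fun b => measurable_innov hY.measurable_Y t b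
  rw [← integral_map (f := f) hm.aemeasurable hf.aestronglyMeasurable, hY.map_innov t,
    integral_map (by fun_prop) hf.aestronglyMeasurable]

lemma memLp_innov [IsProbabilityMeasure P] (hY : IsGaussianVAR P p A Sig Y ε) (t : ℤ)
    (b : Fin d) : MemLp (innov p A Y t b) 2 P := by
  have h : MemLp (fun x : EuclideanSpace ℝ (Fin d) => x b) 2 (P.map (ε t)) := by
    rw [hY.law_err t]
    exact IsGaussian.memLp_dual _ (EuclideanSpace.proj b) 2 (by simp)
  have h2 := (memLp_map_measure_iff (by fun_prop) (hY.measurable_err t).aemeasurable).1 h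
  refine h2.ae_eq ?_
  filter_upwards [hY.innov_ae_eq t] with ω hω
  exact (congrFun hω b).symm

lemma integral_innov [IsProbabilityMeasure P] (hY : IsGaussianVAR P p A Sig Y ε) (t : ℤ)
    (b : Fin d) : ∫ ω, innov p A Y t b ω ∂P = 0 := by
  rw [hY.integral_innov_comp t (f := fun x => x b) (measurable_pi_apply b).stronglyMeasurable]
  have h := ContinuousLinearMap.integral_comp_id_comm
    (μ := multivariateGaussian (0 : EuclideanSpace ℝ (Fin d)) Sig)
    (h := IsGaussian.integrable_id) (L := EuclideanSpace.proj (𝕜 := ℝ) b)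
  simpa [integral_id_multivariateGaussian] using h

lemma integral_innov_mul_innov [IsProbabilityMeasure P] (hY : IsGaussianVAR P p A Sig Y ε) (t : ℤ)
    (b c : Fin d) : ∫ ω, innov p A Y t b ω * innov p A Y t c ω ∂P = Sig b c := by
  rw [hY.integral_innov_comp t (f := fun x => x b * x c) (by fun_prop)]
  rw [← covariance_eval_multivariateGaussian (μ := 0) hY.posDef.posSemidef b c]
  have hi : ∀ a, ∫ x : EuclideanSpace ℝ (Fin d), x a ∂(multivariateGaussian 0 Sig) = 0 := by
    intro a
    rw [← hY.integral_innov t a, hY.integral_innov_comp t (f := fun x => x a)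
      (measurable_pi_apply a).stronglyMeasurable]
  rw [covariance]
  simp [hi]

lemma integral_exp_innov [IsProbabilityMeasure P] (hY : IsGaussianVAR P p A Sig Y ε) (t : ℤ)
    (u : Fin d → ℝ) :
    ∫ ω, Complex.exp ((∑ b, u b * innov p A Y t b ω : ℝ) * Complex.I) ∂P =
      Complex.exp (-(u ⬝ᵥ Sig *ᵥ u : ℝ) / 2) := by
  rw [hY.integral_innov_comp t
    (f := fun x => Complex.exp ((∑ b, u b * x b : ℝ) * Complex.I))
    (Continuous.stronglyMeasurable (by fun_prop))]
  have h := charFun_multivariateGaussian (μ := 0) hY.posDef.posSemidef (WithLp.toLp 2 u)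
  rw [charFun_apply] at h
  simp only [PiLp.inner_apply, inner_zero_right] at h
  convert h using 2
  · ext x
    simp
  · simp [neg_div]

end IsGaussianVAR

end PLVAR

/-! ### Gaussianity of the process from stationarity. -/

lemma Matrix.PosDef.tendsto_zero_of_tendsto_quadratic {ι α : Type*} [Fintype ι] [DecidableEq ι]
    {S : Matrix ι ι ℝ} (hS : S.PosDef) {l : Filter α} {z : α → ι → ℝ}
    (hz : Tendsto (fun n => z n ⬝ᵥ S *ᵥ z n) l (𝓝 0)) (b : ι) :
    Tendsto (fun n => z n b) l (𝓝 0) := by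
  have hdet : IsUnit S.det := (Matrix.isUnit_iff_isUnit_det _).1 hS.isUnit
  set x : ι → ℝ := S⁻¹ *ᵥ Pi.single b 1 with hx
  have hSx : S *ᵥ x = Pi.single b 1 := by
    rw [hx, Matrix.mulVec_mulVec, Matrix.mul_nonsing_inv _ hdet, Matrix.one_mulVec]
  have hT : Sᵀ = S := by
    have := hS.isHermitian
    rwa [Matrix.IsHermitian, Matrix.conjTranspose_eq_transpose_of_trivial] at this
  have hpos : ∀ v : ι → ℝ, 0 ≤ v ⬝ᵥ S *ᵥ v := fun v => by
    simpa using hS.posSemidef.dotProduct_mulVec_nonneg v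
  have hzx : ∀ v : ι → ℝ, v ⬝ᵥ S *ᵥ x = v b := fun v => by rw [hSx]; simp
  have hxz : ∀ v : ι → ℝ, x ⬝ᵥ S *ᵥ v = v b := fun v => by
    rw [Matrix.dotProduct_mulVec, ← Matrix.mulVec_transpose, hT, hSx]; simp
  -- Cauchy–Schwarz for the inner product given by `S`, in which `x` represents the coordinate `b`.
  -- It is obtained from the discriminant of the form along the line `s • x + v`.
  have key : ∀ v : ι → ℝ, (v b) ^ 2 ≤ (v ⬝ᵥ S *ᵥ v) * (x ⬝ᵥ S *ᵥ x) := by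
    intro v
    have h : ∀ s : ℝ, 0 ≤ (x ⬝ᵥ S *ᵥ x) * (s * s) + (2 * v b) * s + v ⬝ᵥ S *ᵥ v := by
      intro s
      have := hpos (s • x + v)
      rw [Matrix.mulVec_add, Matrix.mulVec_smul, add_dotProduct, dotProduct_add, dotProduct_add,
        smul_dotProduct, smul_dotProduct, dotProduct_smul, dotProduct_smul, hzx v, hxz v] at this
      simp only [smul_eq_mul] at this
      linarith
    have := discrim_le_zero h
    rw [discrim] at this
    linarith
  have h2 : Tendsto (fun n => (z n b) ^ 2) l (𝓝 0) := by
    refine tendsto_of_tendsto_of_tendsto_of_le_of_le tendsto_const_nhds ?_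
      (fun n => sq_nonneg _) (fun n => key (z n))
    simpa using hz.mul_const (x ⬝ᵥ S *ᵥ x)
  have h3 := h2.sqrt
  simp only [Real.sqrt_sq_eq_abs, Real.sqrt_zero] at h3
  exact (tendsto_zero_iff_abs_tendsto_zero _).2 h3

namespace PLVAR

variable {Ω : Type*} {d : ℕ}

/-- The lag matrices, extended by zero outside `{1, …, p}`. -/
def lagCoef (p : ℕ) (A : ℕ → Matrix (Fin d) (Fin d) ℝ) (m : ℕ) : Matrix (Fin d) (Fin d) ℝ :=
  if m ∈ Finset.Icc 1 p then A m else 0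

/-- The linear functional of the `M` values of the process up to time `t` with coefficients `u`. -/
def lagSum (Y : ℤ → Ω → EuclideanSpace ℝ (Fin d)) (M : ℕ) (u : ℕ → Fin d → ℝ) (t : ℤ) (ω : Ω) : ℝ :=
  ∑ j ∈ Finset.range M, ∑ b, u j b * Y (t - j) ω b

/-- The coefficients obtained after substituting the autoregressive equation for the most recent
value of the process in a linear functional with coefficients `u`. -/
def lagStep (p : ℕ) (A : ℕ → Matrix (Fin d) (Fin d) ℝ) (u : ℕ → Fin d → ℝ) : ℕ → Fin d → ℝ :=
  fun j b => u (j + 1) b + ∑ a, lagCoef p A (j + 1) a b * u 0 a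

variable {p M : ℕ} {A : ℕ → Matrix (Fin d) (Fin d) ℝ} {u : ℕ → Fin d → ℝ}

lemma lagStep_smul (s : ℝ) : lagStep p A (s • u) = s • lagStep p A u := by
  funext j b
  simp only [lagStep, Pi.smul_apply, smul_eq_mul, mul_add, Finset.mul_sum]
  congr 1
  exact Finset.sum_congr rfl fun a _ => by ring

/-- Homogeneity lets the argument of a characteristic function be absorbed into the coefficients
`u`. -/
lemma iterate_lagStep_smul (s : ℝ) (n : ℕ) :
    (lagStep p A)^[n] (s • u) = s • (lagStep p A)^[n] u := by
  induction n with
  | zero => rfl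
  | succ n ih => rw [Function.iterate_succ_apply', Function.iterate_succ_apply', ih, lagStep_smul]

lemma lagStep_eq_zero (hM : p ≤ M) (hu : ∀ j, M ≤ j → u j = 0) :
    ∀ j, M ≤ j → lagStep p A u j = 0 := by
  intro j hj
  funext b
  have : lagCoef p A (j + 1) = 0 := if_neg (by simp; omega)
  simp [lagStep, this, hu (j + 1) (by omega)]

lemma iterate_lagStep_eq_zero (hM : p ≤ M) (hu : ∀ j, M ≤ j → u j = 0) (n : ℕ) :
    ∀ j, M ≤ j → (lagStep p A)^[n] u j = 0 := by
  induction n with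
  | zero => exact hu
  | succ n ih =>
    rw [Function.iterate_succ_apply']
    exact lagStep_eq_zero hM ih

lemma lagSum_smul (Y : ℤ → Ω → EuclideanSpace ℝ (Fin d)) (s : ℝ) (t : ℤ) (ω : Ω) :
    lagSum Y M (s • u) t ω = s * lagSum Y M u t ω := by
  simp only [lagSum, Pi.smul_apply, smul_eq_mul, Finset.mul_sum, mul_assoc]

lemma sum_lagCoef (hM : p ≤ M) (f : ℕ → ℝ) (b a : Fin d) :
    ∑ j ∈ Finset.range M, lagCoef p A (j + 1) b a * f (j + 1) =
      ∑ m ∈ Finset.Icc 1 p, A m b a * f m := by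
  have h1 : ∑ m ∈ Finset.Icc 1 p, A m b a * f m =
      ∑ m ∈ Finset.Icc 1 p, lagCoef p A m b a * f m :=
    Finset.sum_congr rfl fun m hm => by rw [lagCoef, if_pos hm]
  have h2 : ∑ m ∈ Finset.Ico 1 (M + 1), lagCoef p A m b a * f m =
      ∑ m ∈ Finset.Icc 1 p, lagCoef p A m b a * f m := by
    refine (Finset.sum_subset (fun m hm => ?_) fun m _ hm => ?_).symm
    · simp only [Finset.mem_Icc, Finset.mem_Ico] at hm ⊢
      omega
    · simp [show lagCoef p A m = 0 from if_neg hm]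
  rw [h1, ← h2, Finset.sum_Ico_eq_sum_range]
  simp [add_comm 1]

lemma lagSum_eq_innov_add (Y : ℤ → Ω → EuclideanSpace ℝ (Fin d)) (hM : p < M)
    (hu : ∀ j, M ≤ j → u j = 0) (t : ℤ) (ω : Ω) :
    lagSum Y M u t ω = (∑ b, u 0 b * innov p A Y t b ω) + lagSum Y M (lagStep p A u) (t - 1) ω := by
  have e1 : lagSum Y M u t ω = (∑ j ∈ Finset.range M, ∑ b, u (j + 1) b * Y (t - 1 - j) ω b) +
      ∑ b, u 0 b * Y t ω b := by
    -- The sum over `j ≤ M` is split at both ends: its last term vanishes by `hu`, its first carries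
    -- the value at time `t`.
    have h1 := Finset.sum_range_succ' (fun j : ℕ => ∑ b, u j b * Y (t - j) ω b) M
    rw [Finset.sum_range_succ] at h1
    simp only [hu M le_rfl, Pi.zero_apply, zero_mul, Finset.sum_const_zero, add_zero] at h1
    rw [lagSum, h1]
    simp only [Nat.cast_add, Nat.cast_one, Nat.cast_zero, sub_zero]
    congr 1
    refine Finset.sum_congr rfl fun j _ => Finset.sum_congr rfl fun b _ => ?_
    rw [show t - ((j : ℤ) + 1) = t - 1 - j by ring]
  have e2 : lagSum Y M (lagStep p A u) (t - 1) ω =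
      (∑ j ∈ Finset.range M, ∑ b, u (j + 1) b * Y (t - 1 - j) ω b) +
      ∑ a, u 0 a * ∑ m ∈ Finset.Icc 1 p, ∑ b, A m a b * Y (t - m) ω b := by
    simp only [lagSum, lagStep, add_mul, Finset.sum_add_distrib]
    congr 1
    simp only [Finset.sum_mul]
    rw [Finset.sum_congr rfl fun j _ => Finset.sum_comm, Finset.sum_comm]
    refine Finset.sum_congr rfl fun a _ => ?_
    rw [Finset.sum_comm, Finset.sum_comm (s := Finset.Icc 1 p), Finset.mul_sum]
    refine Finset.sum_congr rfl fun b _ => ?_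
    rw [← sum_lagCoef hM.le (fun m => Y (t - m) ω b) a b, Finset.mul_sum]
    refine Finset.sum_congr rfl fun j _ => ?_
    simp only
    rw [show t - ((j + 1 : ℕ) : ℤ) = t - 1 - j by push_cast; ring]
    ring
  rw [e1, e2]
  simp only [innov, mul_sub, Finset.sum_sub_distrib]
  ring

/-- Downward induction on the lag: `lagStep` builds the coefficient at lag `m` from those at lags `m
+ 1` and `0`, and the coefficients from lag `M` on are zero. -/
lemma tendsto_iterate_lagStep (hM : p ≤ M) (hu : ∀ j, M ≤ j → u j = 0)
    (h0 : ∀ b, Tendsto (fun n => (lagStep p A)^[n] u 0 b) atTop (𝓝 0)) (m : ℕ) (b : Fin d) :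
    Tendsto (fun n => (lagStep p A)^[n] u m b) atTop (𝓝 0) := by
  suffices h : ∀ k m, M ≤ m + k → ∀ b, Tendsto (fun n => (lagStep p A)^[n] u m b) atTop (𝓝 0) from
    h M m (by omega) b
  intro k
  induction k with
  | zero =>
    intro m hm b
    simp [iterate_lagStep_eq_zero hM hu _ m hm]
  | succ k ih =>
    intro m hm b
    rw [← tendsto_add_atTop_iff_nat 1]
    simp_rw [Function.iterate_succ_apply', lagStep]
    have h1 := ih (m + 1) (by omega) b
    have h2 : Tendsto (fun n => ∑ a, lagCoef p A (m + 1) a b * (lagStep p A)^[n] u 0 a) atTop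
        (𝓝 (∑ a, lagCoef p A (m + 1) a b * 0)) :=
      tendsto_finsetSum _ fun a _ => (h0 a).const_mul _
    simpa using h1.add h2

variable [MeasurableSpace Ω]

lemma measurable_lagSum {Y : ℤ → Ω → EuclideanSpace ℝ (Fin d)} (hY : ∀ t, Measurable (Y t))
    (t : ℤ) : Measurable (lagSum Y M u t) := by
  unfold lagSum
  fun_prop

namespace IsGaussianVAR

variable {P : Measure Ω}
  {Sig : Matrix (Fin d) (Fin d) ℝ} {Y ε : ℤ → Ω → EuclideanSpace ℝ (Fin d)}

lemma identDistrib_lagSum (hY : IsGaussianVAR P p A Sig Y ε) (M : ℕ) (u : ℕ → Fin d → ℝ)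
    (t : ℤ) : IdentDistrib (lagSum Y M u t) (lagSum Y M u 0) P P := by
  have h := (hY.stationary t).comp
    (u := fun x : ℤ → EuclideanSpace ℝ (Fin d) =>
      ∑ j ∈ Finset.range M, ∑ b, u j b * x (0 - j) b) (by fun_prop)
  have e : lagSum Y M u t = (fun x : ℤ → EuclideanSpace ℝ (Fin d) =>
      ∑ j ∈ Finset.range M, ∑ b, u j b * x (0 - j) b) ∘ fun ω s => Y (s + t) ω := by
    funext ω
    simp only [lagSum, Function.comp]
    refine Finset.sum_congr rfl fun j _ => Finset.sum_congr rfl fun b _ => ?_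
    rw [show t - (j : ℤ) = 0 - j + t by ring]
  rw [e]
  exact h

variable [IsProbabilityMeasure P]

/-- The innovation part of `lagSum_eq_innov_add` is independent of the remainder, which lies in the
past and, by stationarity, has the law of the same functional at time `0`. -/
lemma integral_exp_lagSum_step (hY : IsGaussianVAR P p A Sig Y ε) (hM : p < M)
    (hu : ∀ j, M ≤ j → u j = 0) :
    ∫ ω, Complex.exp (lagSum Y M u 0 ω * Complex.I) ∂P =
      Complex.exp (-(u 0 ⬝ᵥ Sig *ᵥ u 0 : ℝ) / 2) *
        ∫ ω, Complex.exp (lagSum Y M (lagStep p A u) 0 ω * Complex.I) ∂P := by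
  have h1 : IndepFun (fun ω => Complex.exp ((∑ b, u 0 b * innov p A Y 0 b ω : ℝ) * Complex.I))
      (fun ω => Complex.exp (lagSum Y M (lagStep p A u) (0 - 1) ω * Complex.I)) P := by
    refine hY.indepFun_innov 0
      (f := fun x => Complex.exp ((∑ b, u 0 b * x b : ℝ) * Complex.I)) (by fun_prop) ?_
    have : Measurable[past Y 0] (lagSum Y M (lagStep p A u) (0 - 1)) := by
      unfold lagSum
      refine Finset.measurable_sum _ fun m _ => Finset.measurable_sum _ fun a _ => ?_
      exact (measurable_past (by omega) a).const_mul _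
    fun_prop
  have h2 := ((hY.identDistrib_lagSum M (lagStep p A u) (0 - 1)).comp
    (u := fun x : ℝ => Complex.exp (x * Complex.I)) (by fun_prop)).integral_eq
  simp only [Function.comp_apply] at h2
  rw [← h2, ← hY.integral_exp_innov 0 (u 0), ← h1.integral_fun_mul_eq_mul_integral]
  · refine integral_congr_ae (ae_of_all _ fun ω => ?_)
    simp only
    rw [lagSum_eq_innov_add (A := A) Y hM hu, ← Complex.exp_add]
    push_cast
    ring_nf
  · have := fun b => measurable_innov (p := p) (A := A) hY.measurable_Y 0 b
    exact Measurable.aestronglyMeasurable (by fun_prop)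
  · have := measurable_lagSum (M := M) (u := lagStep p A u) hY.measurable_Y (0 - 1)
    exact Measurable.aestronglyMeasurable (by fun_prop)

lemma integral_exp_lagSum_iterate (hY : IsGaussianVAR P p A Sig Y ε) (hM : p < M)
    (hu : ∀ j, M ≤ j → u j = 0) (n : ℕ) :
    ∫ ω, Complex.exp (lagSum Y M u 0 ω * Complex.I) ∂P =
      Complex.exp (-(∑ j ∈ Finset.range n,
        (lagStep p A)^[j] u 0 ⬝ᵥ Sig *ᵥ (lagStep p A)^[j] u 0 : ℝ) / 2) *
        ∫ ω, Complex.exp (lagSum Y M ((lagStep p A)^[n] u) 0 ω * Complex.I) ∂P := by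
  induction n with
  | zero => simp
  | succ n ih =>
    rw [ih, hY.integral_exp_lagSum_step hM (iterate_lagStep_eq_zero hM.le hu n), ← mul_assoc,
      ← Complex.exp_add, Finset.sum_range_succ, Function.iterate_succ_apply']
    congr 2
    push_cast
    ring

lemma norm_integral_exp_le (f : Ω → ℝ) :
    ‖∫ ω, Complex.exp (f ω * Complex.I) ∂P‖ ≤ 1 := by
  have := norm_integral_le_of_norm_le_const (μ := P) (f := fun ω => Complex.exp (f ω * Complex.I))
    (C := 1) (ae_of_all _ fun ω => (Complex.norm_exp_ofReal_mul_I _).le)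
  simpa using this

lemma tendsto_integral_exp {f : ℕ → Ω → ℝ} (hf : ∀ n, Measurable (f n))
    (h : ∀ ω, Tendsto (fun n => f n ω) atTop (𝓝 0)) :
    Tendsto (fun n => ∫ ω, Complex.exp (f n ω * Complex.I) ∂P) atTop (𝓝 1) := by
  have := tendsto_integral_of_dominated_convergence (μ := P)
    (F := fun n ω => Complex.exp (f n ω * Complex.I)) (f := fun _ => (1 : ℂ)) (fun _ => (1 : ℝ))
    (fun n => Measurable.aestronglyMeasurable (by have := hf n; fun_prop))
    (integrable_const _)
    (fun n => ae_of_all _ fun ω => (Complex.norm_exp_ofReal_mul_I _).le)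
    (ae_of_all _ fun ω => by
      have h1 : Continuous fun x : ℝ => Complex.exp (x * Complex.I) := by fun_prop
      have h2 := (h1.tendsto 0).comp (h ω)
      simp only [Complex.ofReal_zero, zero_mul, Complex.exp_zero] at h2
      exact h2)
  simpa using this

/-- Stationarity forces the quadratic forms along the backward recursion to be summable. -/
lemma summable_quadratic (hY : IsGaussianVAR P p A Sig Y ε) (hM : p < M)
    (hu : ∀ j, M ≤ j → u j = 0) :
    Summable fun j => (lagStep p A)^[j] u 0 ⬝ᵥ Sig *ᵥ (lagStep p A)^[j] u 0 := by
  have hpos : ∀ v : Fin d → ℝ, 0 ≤ v ⬝ᵥ Sig *ᵥ v := fun v => by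
    simpa using hY.posDef.posSemidef.dotProduct_mulVec_nonneg v
  have h1 : Tendsto (fun n : ℕ => ‖∫ ω, Complex.exp
      (lagSum Y M (((n : ℝ) + 1)⁻¹ • u) 0 ω * Complex.I) ∂P‖) atTop (𝓝 1) := by
    have : Tendsto (fun n : ℕ => ((n : ℝ) + 1)⁻¹) atTop (𝓝 0) := by
      simpa using tendsto_one_div_add_atTop_nhds_zero_nat (𝕜 := ℝ)
    have h := (tendsto_integral_exp (P := P)
      (f := fun n => lagSum Y M (((n : ℝ) + 1)⁻¹ • u) 0)
      (fun n => measurable_lagSum hY.measurable_Y 0) (fun ω => by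
        simp_rw [lagSum_smul]
        simpa using this.mul_const (lagSum Y M u 0 ω))).norm
    simpa using h
  -- At a small enough scale `s` the characteristic function has modulus above `1/2`. The iteration
  -- bounds this modulus by `exp (-s² S / 2)` for each partial sum `S`, whence `S ≤ 2 log 2 / s²`.
  obtain ⟨N, hN⟩ := (h1.eventually (lt_mem_nhds (show (1 / 2 : ℝ) < 1 by norm_num))).exists
  set s : ℝ := ((N : ℝ) + 1)⁻¹ with hs
  have hs0 : 0 < s := by positivity
  refine summable_of_sum_range_le (c := 2 * Real.log 2 / s ^ 2) (fun j => hpos _) fun n => ?_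
  have h2 := hY.integral_exp_lagSum_iterate (u := s • u) hM (fun j hj => by simp [hu j hj]) n
  rw [h2, norm_mul, Complex.norm_exp] at hN
  have h3 := norm_integral_exp_le (P := P) (lagSum Y M ((lagStep p A)^[n] (s • u)) 0)
  have h4 := hN.trans_le (mul_le_of_le_one_right (Real.exp_pos _).le h3)
  simp_rw [iterate_lagStep_smul, Pi.smul_apply, Matrix.mulVec_smul, smul_dotProduct,
    dotProduct_smul, smul_eq_mul, ← mul_assoc, ← Finset.mul_sum] at h4
  rw [← Real.log_lt_iff_lt_exp (by norm_num)] at h4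
  rw [le_div_iff₀ (by positivity)]
  have h5 : ∀ x : ℝ, (-(x : ℂ) / 2).re = -x / 2 := fun x => by
    rw [← Complex.ofReal_neg]
    simp
  rw [h5, one_div, Real.log_inv] at h4
  nlinarith

/-- Linear functionals of a stationary Gaussian autoregression are centred Gaussian. -/
lemma hasGaussianLaw_lagSum (hY : IsGaussianVAR P p A Sig Y ε) (hM : p < M)
    (hu : ∀ j, M ≤ j → u j = 0) (t : ℤ) : HasGaussianLaw (lagSum Y M u t) P := by
  have hpos : ∀ v : Fin d → ℝ, 0 ≤ v ⬝ᵥ Sig *ᵥ v := fun v => by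
    simpa using hY.posDef.posSemidef.dotProduct_mulVec_nonneg v
  have hsum := hY.summable_quadratic hM hu
  -- This replaces a spectral condition on the lag matrices: summable quadratic forms tend to zero,
  -- hence so do the iterated coefficients.
  have h0 : ∀ b, Tendsto (fun n => (lagStep p A)^[n] u 0 b) atTop (𝓝 0) :=
    hY.posDef.tendsto_zero_of_tendsto_quadratic hsum.tendsto_atTop_zero
  have hT := tendsto_iterate_lagStep hM.le hu h0
  set Q := ∑' j, (lagStep p A)^[j] u 0 ⬝ᵥ Sig *ᵥ (lagStep p A)^[j] u 0 with hQ
  have hQ0 : 0 ≤ Q := tsum_nonneg fun j => hpos _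
  -- In the limit of the iteration the remaining factor tends to `1`, and only the characteristic
  -- function of `N(0, Q)` is left.
  have key : ∀ s : ℝ, ∫ ω, Complex.exp (lagSum Y M (s • u) 0 ω * Complex.I) ∂P =
      Complex.exp (-(s ^ 2 * Q : ℝ) / 2) := by
    intro s
    have h1 : Tendsto (fun n => ∫ ω, Complex.exp
        (lagSum Y M ((lagStep p A)^[n] (s • u)) 0 ω * Complex.I) ∂P) atTop (𝓝 1) := by
      refine tendsto_integral_exp (fun n => measurable_lagSum hY.measurable_Y 0) fun ω => ?_
      simp_rw [iterate_lagStep_smul, lagSum_smul]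
      have : Tendsto (fun n => lagSum Y M ((lagStep p A)^[n] u) 0 ω) atTop
          (𝓝 (∑ j ∈ Finset.range M, ∑ b, 0 * Y (0 - j) ω b)) :=
        tendsto_finsetSum _ fun j _ => tendsto_finsetSum _ fun b _ => (hT j b).mul_const _
      simpa using this.const_mul s
    have h2 : Tendsto (fun n => Complex.exp (-(∑ j ∈ Finset.range n,
        (lagStep p A)^[j] (s • u) 0 ⬝ᵥ Sig *ᵥ (lagStep p A)^[j] (s • u) 0 : ℝ) / 2)) atTop
        (𝓝 (Complex.exp (-(s ^ 2 * Q : ℝ) / 2))) := by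
      have hc : Continuous fun x : ℝ => Complex.exp (-(x : ℂ) / 2) := by fun_prop
      refine (hc.tendsto _).comp ?_
      simp_rw [iterate_lagStep_smul, Pi.smul_apply, Matrix.mulVec_smul, smul_dotProduct,
        dotProduct_smul, smul_eq_mul, ← mul_assoc, ← Finset.mul_sum, ← pow_two]
      exact hsum.hasSum.tendsto_sum_nat.const_mul _
    have h3 := h2.mul h1
    rw [mul_one] at h3
    refine tendsto_nhds_unique (tendsto_const_nhds.congr fun n => ?_) h3
    exact hY.integral_exp_lagSum_iterate hM (fun j hj => by simp [hu j hj]) n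
  have hlaw : P.map (lagSum Y M u 0) = gaussianReal 0 Q.toNNReal := by
    have : IsProbabilityMeasure (P.map (lagSum Y M u 0)) :=
      Measure.isProbabilityMeasure_map (measurable_lagSum hY.measurable_Y 0).aemeasurable
    refine Measure.ext_of_charFun ?_
    funext s
    rw [charFun_gaussianReal, charFun_apply_real, integral_map
      (measurable_lagSum hY.measurable_Y 0).aemeasurable
      (Measurable.aestronglyMeasurable (by fun_prop))]
    have := key s
    simp_rw [lagSum_smul] at this
    push_cast at this
    rw [this]
    simp only [Real.coe_toNNReal _ hQ0]
    push_cast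
    ring_nf
  constructor
  rw [(hY.identDistrib_lagSum M u t).map_eq, hlaw]
  infer_instance

end IsGaussianVAR

end PLVAR

/-! ### Laws of large numbers for products involving innovations. -/

namespace PLVAR

variable {Ω : Type*} [MeasurableSpace Ω] {d p : ℕ} {A : ℕ → Matrix (Fin d) (Fin d) ℝ}

/-- All the variables `f t` have mean `c`, and the averages of `f` over windows of increasing length
converge to `c` in probability. -/
structure HasMean (P : Measure Ω) (f : ℤ → Ω → ℝ) (c : ℝ) : Prop where
  integrable : ∀ t, Integrable (f t) P
  mean : ∀ t, ∫ ω, f t ω ∂P = c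
  lln : ∀ s : ℤ, Tendsto (fun q : ℕ × Ω => (∑ j ∈ Finset.range q.1, f (s + j) q.2) / q.1)
    (probFilter P) (𝓝 c)

namespace HasMean

variable {P : Measure Ω} {f g : ℤ → Ω → ℝ} {c c' : ℝ}

lemma add (hf : HasMean P f c) (hg : HasMean P g c') :
    HasMean P (fun t ω => f t ω + g t ω) (c + c') where
  integrable t := (hf.integrable t).add (hg.integrable t)
  mean t := by rw [integral_add (hf.integrable t) (hg.integrable t), hf.mean, hg.mean]
  lln s := by
    refine ((hf.lln s).add (hg.lln s)).congr fun q => ?_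
    rw [Finset.sum_add_distrib, add_div]

lemma const_mul (hf : HasMean P f c) (r : ℝ) : HasMean P (fun t ω => r * f t ω) (r * c) where
  integrable t := (hf.integrable t).const_mul r
  mean t := by rw [integral_const_mul, hf.mean]
  lln s := by
    refine ((hf.lln s).const_mul r).congr fun q => ?_
    rw [← Finset.mul_sum, mul_div_assoc]

lemma zero : HasMean P (fun _ _ => 0) 0 where
  integrable t := integrable_zero _ _ _
  mean t := by simp
  lln s := tendsto_const_nhds.congr fun q => by simp

lemma sum {ι : Type*} {F : ι → ℤ → Ω → ℝ} {C : ι → ℝ} {I : Finset ι}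
    (h : ∀ i ∈ I, HasMean P (F i) (C i)) :
    HasMean P (fun t ω => ∑ i ∈ I, F i t ω) (∑ i ∈ I, C i) := by
  classical
  induction I using Finset.induction_on with
  | empty => simpa using zero
  | insert a I ha ih =>
    simp_rw [Finset.sum_insert ha]
    exact (h a (by simp)).add (ih fun i hi => h i (by simp [hi]))

lemma shift (hf : HasMean P f c) (k : ℤ) : HasMean P (fun t => f (t + k)) c where
  integrable t := hf.integrable _
  mean t := hf.mean _
  lln s := by
    refine (hf.lln (s + k)).congr fun q => ?_
    simp only [add_right_comm]

lemma congr (hf : HasMean P f c) (h : ∀ t ω, f t ω = g t ω) (hc : c = c') : HasMean P g c' := by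
  have : f = g := funext fun t => funext fun ω => h t ω
  rwa [← this, ← hc]

end HasMean

namespace IsGaussianVAR

variable {P : Measure Ω} {Sig : Matrix (Fin d) (Fin d) ℝ}
  {Y ε : ℤ → Ω → EuclideanSpace ℝ (Fin d)}

lemma integral_eval_sq (hY : IsGaussianVAR P p A Sig Y ε) (t : ℤ) (b : Fin d) :
    ∫ ω, Y t ω b ^ 2 ∂P = ∫ ω, Y 0 ω b ^ 2 ∂P := by
  have h := ((hY.stationary t).comp
    (u := fun x : ℤ → EuclideanSpace ℝ (Fin d) => x 0 b ^ 2) (by fun_prop)).integral_eq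
  simpa using h

variable [IsProbabilityMeasure P]

/-- The variables of a stationary Gaussian autoregression form a Gaussian process. -/
lemma isGaussianProcess (hY : IsGaussianVAR P p A Sig Y ε) :
    IsGaussianProcess (fun (w : Fin d × ℤ) ω => Y w.2 ω w.1) P := by
  classical
  have hsum : ∀ (I : Finset (Fin d × ℤ)) (c : Fin d × ℤ → ℝ),
      HasGaussianLaw (fun ω => ∑ w ∈ I, c w * Y w.2 ω w.1) P := by
    intro I c
    obtain ⟨N, hN⟩ : ∃ N : ℕ, ∀ w ∈ I, w.2.natAbs ≤ N :=
      ⟨I.sup fun w => w.2.natAbs, fun w hw => Finset.le_sup (f := fun w : Fin d × ℤ => w.2.natAbs) hw⟩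
    -- Going back `M` values from time `N` covers all times in `[-N, N]`, and `p < M`.
    set M := p + 2 * N + 1 with hM
    let u : ℕ → Fin d → ℝ := fun j b =>
      if j < M ∧ (b, (N : ℤ) - j) ∈ I then c (b, (N : ℤ) - j) else 0
    have h := hY.hasGaussianLaw_lagSum (M := M) (u := u) (by omega)
      (fun j hj => by
        funext b
        simp [u, not_lt.2 hj]) N
    refine h.congr (ae_of_all _ fun ω => ?_)
    simp only [lagSum]
    rw [← Finset.sum_product' (f := fun (j : ℕ) (b : Fin d) => u j b * Y (N - j) ω b)]
    symm
    refine Finset.sum_bij_ne_zero (fun w _ _ => (((N : ℤ) - w.2).toNat, w.1)) ?_ ?_ ?_ ?_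
    · intro w hw _
      have := hN w hw
      simp only [Finset.mem_product, Finset.mem_range, Finset.mem_univ, and_true]
      omega
    · rintro ⟨b, s⟩ hw _ ⟨b', s'⟩ hw' _ he
      have h1 := hN _ hw
      have h2 := hN _ hw'
      simp only [Prod.mk.injEq] at he h1 h2 ⊢
      exact ⟨he.2, by omega⟩
    · rintro ⟨j, b⟩ hj hne
      have hmem : j < M ∧ (b, (N : ℤ) - j) ∈ I := by
        by_contra hc
        exact hne (by simp [u, if_neg hc])
      refine ⟨(b, (N : ℤ) - j), hmem.2, ?_, ?_⟩
      · simpa [u, hmem.1, hmem.2] using hne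
      · simp
    · rintro ⟨b, s⟩ hw _
      have h1 := hN _ hw
      simp only at h1
      have e : (N : ℤ) - (((N : ℤ) - s).toNat : ℤ) = s := by omega
      have hlt : ((N : ℤ) - s).toNat < M := by omega
      simp only [u, e, hw, hlt, and_self, if_true]
  have hm : ∀ I : Finset (Fin d × ℤ), Measurable
      (fun ω => I.restrict fun w : Fin d × ℤ => Y w.2 ω w.1) := fun I => by
    refine measurable_pi_lambda _ fun w => ?_
    have := hY.measurable_Y w.1.2
    simp only [Finset.restrict]
    fun_prop
  refine ⟨fun I => ⟨isGaussian_of_isGaussian_map fun L => ?_⟩⟩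
  rw [Measure.map_map (by fun_prop) (hm I)]
  let c : Fin d × ℤ → ℝ := fun w => if h : w ∈ I then L (Pi.single ⟨w, h⟩ 1) else 0
  have e : L ∘ (fun ω => I.restrict fun w : Fin d × ℤ => Y w.2 ω w.1) =
      fun ω => ∑ w ∈ I, c w * Y w.2 ω w.1 := by
    funext ω
    rw [Function.comp_apply, ← Finset.sum_coe_sort I fun w => c w * Y w.2 ω w.1]
    conv_lhs => rw [← Finset.univ_sum_single (I.restrict fun w : Fin d × ℤ => Y w.2 ω w.1)]
    rw [map_sum]
    refine Finset.sum_congr rfl fun w _ => ?_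
    have : (Pi.single w (I.restrict (fun w : Fin d × ℤ => Y w.2 ω w.1) w) : I → ℝ) =
        (Y w.1.2 ω w.1.1) • Pi.single w 1 := by
      rw [← Pi.single_smul]
      simp
    rw [this, map_smul, smul_eq_mul, mul_comm]
    simp [c]
  rw [e]
  exact (hsum I c).isGaussian_map

lemma memLp_eval (hY : IsGaussianVAR P p A Sig Y ε) (t : ℤ) (b : Fin d) :
    MemLp (fun ω => Y t ω b) 2 P :=
  (hY.isGaussianProcess.hasGaussianLaw_eval (b, t)).memLp_two

/-- Second moments of sums of products of innovations and past-measurable variables. -/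
lemma integral_sq_sum_innov_mul (hY : IsGaussianVAR P p A Sig Y ε) {x : ℤ → Ω → ℝ} {K : ℝ}
    (hm : ∀ t, Measurable[past Y t] (x t)) (hL : ∀ t, MemLp (x t) 2 P)
    (hK : ∀ t, ∫ ω, x t ω ^ 2 ∂P = K) (b : Fin d) (s : ℤ) (n : ℕ) :
    Integrable (fun ω => (∑ j ∈ Finset.range n, innov p A Y (s + j) b ω * x (s + j) ω) ^ 2) P ∧
      ∫ ω, (∑ j ∈ Finset.range n, innov p A Y (s + j) b ω * x (s + j) ω) ^ 2 ∂P =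
        n * (Sig b b * K) := by
  have hind : ∀ t, IndepFun (fun ω => innov p A Y t b ω ^ 2) (fun ω => x t ω ^ 2) P := fun t =>
    hY.indepFun_innov t (f := fun v => v b ^ 2) (by fun_prop) ((hm t).pow_const 2)
  have hx : ∀ t, Measurable (x t) := fun t => (hm t).mono (past_le hY.measurable_Y t) le_rfl
  have he : ∀ t, Measurable (innov p A Y t b) := fun t => measurable_innov hY.measurable_Y t b
  refine integral_sq_sum_of_orthogonal
    (ξ := fun j ω => innov p A Y (s + j) b ω * x (s + j) ω) (fun j => ?_) (fun j => ?_) ?_ n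
  · refine (memLp_two_iff_integrable_sq ((he _).mul (hx _)).aestronglyMeasurable).2 ?_
    simp only [Pi.mul_apply]
    simp_rw [mul_pow]
    exact (hind (s + j)).integrable_mul (hY.memLp_innov _ b).integrable_sq (hL _).integrable_sq
  · simp_rw [mul_pow]
    rw [(hind (s + j)).integral_fun_mul_eq_mul_integral
      ((he _).pow_const 2).aestronglyMeasurable ((hx _).pow_const 2).aestronglyMeasurable, hK]
    simp_rw [pow_two]
    rw [hY.integral_innov_mul_innov]
  · intro i j hij
    -- For `i < j` every factor except the innovation at time `s + j` is measurable with respect to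
    -- the past of `s + j`, so that centred innovation splits off.
    have h := hY.indepFun_innov (s + j) (f := fun v => v b) (by fun_prop)
      (g := fun ω => innov p A Y (s + i) b ω * x (s + i) ω * x (s + j) ω)
      (((measurable_past_innov (by omega) b).mul ((hm (s + i)).mono
        (biSup_mono fun w hw => lt_trans (Set.mem_ofPred.1 hw) (by omega)) le_rfl)).mul (hm _))
    have h2 := h.integral_fun_mul_eq_mul_integral (he _).aestronglyMeasurable
      (((he _).mul (hx _)).mul (hx _)).aestronglyMeasurable
    rw [hY.integral_innov, zero_mul] at h2
    rw [← h2]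
    refine integral_congr_ae (ae_of_all _ fun ω => ?_)
    simp only
    ring

/-- The summands are orthogonal with a common second moment, so their average has second moment of
order `1 / n` and Chebyshev's inequality suffices. -/
lemma hasMean_innov_mul (hY : IsGaussianVAR P p A Sig Y ε) {x : ℤ → Ω → ℝ} {K : ℝ}
    (hm : ∀ t, Measurable[past Y t] (x t)) (hL : ∀ t, MemLp (x t) 2 P)
    (hK : ∀ t, ∫ ω, x t ω ^ 2 ∂P = K) (b : Fin d) :
    HasMean P (fun t ω => innov p A Y t b ω * x t ω) 0 where
  integrable t := (hY.memLp_innov t b).integrable_mul (hL t)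
  mean t := by
    have h := hY.indepFun_innov t (f := fun v => v b) (by fun_prop) (hm t)
    rw [h.integral_fun_mul_eq_mul_integral (hY.memLp_innov t b).1 (hL t).1, hY.integral_innov,
      zero_mul]
  lln s := by
    have h := hY.integral_sq_sum_innov_mul hm hL hK b s
    refine tendsto_probFilter_zero_of_sq
      (f := fun n ω => (∑ j ∈ Finset.range n, innov p A Y (s + j) b ω * x (s + j) ω) / n)
      (b := fun n => (Sig b b * K) / n) ?_ ?_ ?_
    · intro n
      simp_rw [div_pow]
      exact (h n).1.div_const _
    · intro n
      simp_rw [div_pow]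
      rw [integral_div, (h n).2]
      rcases eq_or_ne (n : ℝ) 0 with h0 | h0
      · simp [h0]
      · rw [div_le_div_iff₀ (by positivity) (by positivity)]
        ring_nf
        rfl
    · exact tendsto_const_div_atTop_nhds_zero_nat _

/-- Both factors are contemporaneous, so the orthogonality argument does not apply; the products are
instead identically distributed and pairwise independent, and the strong law applies. -/
lemma hasMean_innov_mul_innov_self (hY : IsGaussianVAR P p A Sig Y ε) (b c : Fin d) :
    HasMean P (fun t ω => innov p A Y t b ω * innov p A Y t c ω) (Sig b c) where
  integrable t := (hY.memLp_innov t b).integrable_mul (hY.memLp_innov t c)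
  mean t := hY.integral_innov_mul_innov t b c
  lln s := by
    have he : ∀ t b, Measurable (innov p A Y t b) := fun t b => measurable_innov hY.measurable_Y t b
    let X : ℕ → Ω → ℝ := fun j ω => innov p A Y (s + j) b ω * innov p A Y (s + j) c ω
    have hX : ∀ j, Measurable (X j) := fun j => (he _ b).mul (he _ c)
    have hind : ∀ i j, i < j → IndepFun (X j) (X i) P := fun i j hij =>
      hY.indepFun_innov (s + j) (f := fun v => v b * v c) (by fun_prop)
        ((measurable_past_innov (by omega) b).mul (measurable_past_innov (by omega) c))
    have h := strong_law_ae_real X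
      ((hY.memLp_innov _ b).integrable_mul (hY.memLp_innov _ c))
      (fun i j hij => by
        rcases lt_or_gt_of_ne hij with h | h
        · exact (hind i j h).symm
        · exact hind j i h)
      (fun j => by
        have : IdentDistrib (fun ω b => innov p A Y (s + j) b ω)
            (fun ω b => innov p A Y (s + (0 : ℕ)) b ω) P P :=
          ⟨(measurable_pi_lambda _ fun b => he _ b).aemeasurable,
            (measurable_pi_lambda _ fun b => he _ b).aemeasurable, by
              rw [hY.map_innov, hY.map_innov]⟩
        exact this.comp (u := fun v => v b * v c) (by fun_prop))
    have hmean : ∫ ω, X 0 ω ∂P = Sig b c := hY.integral_innov_mul_innov _ b c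
    rw [hmean] at h
    refine tendsto_probFilter_of_ae (f := fun n ω => (∑ j ∈ Finset.range n, X j ω) / n) ?_ h
    intro n
    exact ((Finset.measurable_sum _ fun j _ => hX j).div_const _).aestronglyMeasurable

lemma hasMean_innov_mul_eval (hY : IsGaussianVAR P p A Sig Y ε) (b c : Fin d) {h : ℤ} (hh : h < 0) :
    HasMean P (fun t ω => innov p A Y t b ω * Y (t + h) ω c) 0 :=
  hY.hasMean_innov_mul (fun t => measurable_past (by omega) c) (fun t => hY.memLp_eval _ c)
    (fun t => hY.integral_eval_sq _ c) b

lemma hasMean_innov_mul_innov (hY : IsGaussianVAR P p A Sig Y ε) (b c : Fin d) (m h : ℤ) :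
    HasMean P (fun t ω => innov p A Y (t + m) b ω * innov p A Y (t + h) c ω)
      (if m = h then Sig b c else 0) := by
  have key : ∀ (b c : Fin d) (m h : ℤ), h < m →
      HasMean P (fun t ω => innov p A Y (t + m) b ω * innov p A Y (t + h) c ω) 0 := by
    intro b c m h hmh
    have h1 := (hY.hasMean_innov_mul (x := fun t => innov p A Y (t + (h - m)) c)
      (fun t => measurable_past_innov (by omega) c)
      (fun t => hY.memLp_innov _ c) (K := Sig c c)
      (fun t => by simpa [pow_two] using hY.integral_innov_mul_innov _ c c) b).shift m
    refine h1.congr (fun t ω => ?_) rfl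
    rw [show t + m + (h - m) = t + h by ring]
  rcases lt_trichotomy m h with hmh | hmh | hmh
  · rw [if_neg hmh.ne]
    exact (key c b h m hmh).congr (fun t ω => mul_comm _ _) rfl
  · subst hmh
    rw [if_pos rfl]
    exact (hY.hasMean_innov_mul_innov_self b c).shift m
  · rw [if_neg hmh.ne']
    exact key b c m h hmh

end IsGaussianVAR

end PLVAR

/-! ### Dual variables to the history. -/

namespace PLVAR

variable {Ω : Type*} {d p : ℕ} {A : ℕ → Matrix (Fin d) (Fin d) ℝ}
  {Sig : Matrix (Fin d) (Fin d) ℝ} {Y ε : ℤ → Ω → EuclideanSpace ℝ (Fin d)}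

/-- The weights of the innovations in `dualVar`. -/
noncomputable def dualWeight (p : ℕ) (A : ℕ → Matrix (Fin d) (Fin d) ℝ) (Sig : Matrix (Fin d) (Fin d) ℝ)
    (a : Fin d) (m : ℕ) : Fin d → ℝ :=
  if m = 0 then Sig⁻¹ *ᵥ Pi.single a 1 else -(Sig⁻¹ *ᵥ fun b => lagCoef p A m b a)

/-- A linear combination of the innovations at times `t, …, t + l - 1` that has covariance one with
`Y_t^a` and is uncorrelated with all the other variables of the process before time `t + l`. -/
noncomputable def dualVar (p : ℕ) (A : ℕ → Matrix (Fin d) (Fin d) ℝ) (Sig : Matrix (Fin d) (Fin d) ℝ)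
    (Y : ℤ → Ω → EuclideanSpace ℝ (Fin d)) (l : ℕ) (a : Fin d) (t : ℤ) (ω : Ω) : ℝ :=
  ∑ m ∈ Finset.range l, ∑ b, dualWeight p A Sig a m b * innov p A Y (t + m) b ω

/-- Up to sign, `dualVar` is the derivative with respect to `Y_t^a` of the Gaussian log-likelihood
`-½ ∑ εᵀ Sig⁻¹ ε` over times `t, …, t + l - 1`; this explains the weights. Their covariances with
the innovations, computed here, are what cancels the autoregressive terms in
`hasMean_dualVar_mul_eval`. -/
lemma sum_dualWeight_mul (hS : Sig.PosDef) (a c : Fin d) (m : ℕ) :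
    ∑ b, dualWeight p A Sig a m b * Sig b c =
      if m = 0 then (if c = a then 1 else 0) else -lagCoef p A m c a := by
  have hdet : IsUnit Sig.det := (Matrix.isUnit_iff_isUnit_det _).1 hS.isUnit
  have hT : ∀ b c, Sig b c = Sig c b := fun b c => by
    simpa using (hS.isHermitian.apply b c).symm
  have h : ∑ b, dualWeight p A Sig a m b * Sig b c = (Sig *ᵥ dualWeight p A Sig a m) c := by
    simp only [Matrix.mulVec, dotProduct]
    exact Finset.sum_congr rfl fun b _ => by rw [hT b c, mul_comm]
  rw [h, dualWeight]
  split_ifs with h0 hc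
  · rw [Matrix.mulVec_mulVec, Matrix.mul_nonsing_inv _ hdet, Matrix.one_mulVec, hc]
    simp
  · rw [Matrix.mulVec_mulVec, Matrix.mul_nonsing_inv _ hdet, Matrix.one_mulVec]
    simp [hc]
  · rw [Matrix.mulVec_neg, Matrix.mulVec_mulVec, Matrix.mul_nonsing_inv _ hdet, Matrix.one_mulVec]
    simp

lemma eval_eq_innov_add (t : ℤ) (c : Fin d) (ω : Ω) :
    Y t ω c = innov p A Y t c ω + ∑ m ∈ Finset.Icc 1 p, ∑ b, A m c b * Y (t - m) ω b := by
  simp [innov]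

lemma innov_mem_span {s t : ℤ} (h : s < t) (b : Fin d) :
    innov p A Y s b ∈ Submodule.span ℝ
      (Set.range fun (w : {w : Fin d × ℤ // w.2 < t}) ω => Y w.1.2 ω w.1.1) := by
  have hs : ∀ r < t, ∀ c, (fun ω => Y r ω c) ∈ Submodule.span ℝ
      (Set.range fun (w : {w : Fin d × ℤ // w.2 < t}) ω => Y w.1.2 ω w.1.1) := fun r hr c =>
    Submodule.subset_span ⟨⟨(c, r), hr⟩, rfl⟩
  have e : innov p A Y s b = (fun ω => Y s ω b) -
      ∑ m ∈ Finset.Icc 1 p, ∑ a, A m b a • fun ω => Y (s - m) ω a := by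
    funext ω
    simp [innov, Finset.sum_apply]
  rw [e]
  refine Submodule.sub_mem _ (hs s h b) ?_
  exact Submodule.sum_mem _ fun m _ => Submodule.sum_mem _ fun a _ =>
    Submodule.smul_mem _ _ (hs _ (by omega) a)

lemma dualVar_mem_span (l : ℕ) (a : Fin d) (t : ℤ) :
    dualVar p A Sig Y l a t ∈ Submodule.span ℝ
      (Set.range fun (w : {w : Fin d × ℤ // w.2 < t + l}) ω => Y w.1.2 ω w.1.1) := by
  have e : dualVar p A Sig Y l a t =
      ∑ m ∈ Finset.range l, ∑ b, dualWeight p A Sig a m b • innov p A Y (t + m) b := by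
    funext ω
    simp [dualVar, Finset.sum_apply]
  rw [e]
  refine Submodule.sum_mem _ fun m hm => Submodule.sum_mem _ fun b _ =>
    Submodule.smul_mem _ _ (innov_mem_span ?_ b)
  have := Finset.mem_range.1 hm
  omega

/-- A linear combination of the history splits into a multiple of a given variable and a function
of the rest of the history. -/
lemma exists_eq_mul_add_of_mem_span {t : ℤ} {v : Fin d × ℤ} {f : Ω → ℝ}
    (hf : f ∈ Submodule.span ℝ
      (Set.range fun (w : {w : Fin d × ℤ // w.2 < t}) ω => Y w.1.2 ω w.1.1)) :
    ∃ (r : ℝ) (g : Ω → ℝ), Measurable[historyWithout Y t v] g ∧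
      ∀ ω, f ω = r * Y v.2 ω v.1 + g ω := by
  induction hf using Submodule.span_induction with
  | mem x hx =>
    obtain ⟨w, rfl⟩ := hx
    by_cases hw : w.1 = v
    · exact ⟨1, 0, measurable_const, fun ω => by simp [hw]⟩
    · exact ⟨0, _, measurable_historyWithout w.2 hw, fun ω => by simp⟩
  | zero => exact ⟨0, 0, measurable_const, fun ω => by simp⟩
  | add x y _ _ hx hy =>
    obtain ⟨r, g, hg, h⟩ := hx
    obtain ⟨r', g', hg', h'⟩ := hy
    exact ⟨r + r', g + g', hg.add hg', fun ω => by simp only [Pi.add_apply, h, h']; ring⟩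
  | smul c x _ hx =>
    obtain ⟨r, g, hg, h⟩ := hx
    exact ⟨c * r, c • g, hg.const_smul c, fun ω => by
      simp only [Pi.smul_apply, smul_eq_mul, h]; ring⟩

lemma measurable_past_dualVar (l : ℕ) (a : Fin d) (t : ℤ) :
    Measurable[past Y (t + l)] (dualVar p A Sig Y l a t) := by
  unfold dualVar
  refine Finset.measurable_sum _ fun m hm => Finset.measurable_sum _ fun b _ => ?_
  have := Finset.mem_range.1 hm
  exact (measurable_past_innov (by omega) b).const_mul _

variable [MeasurableSpace Ω]

namespace IsGaussianVAR

variable {P : Measure Ω}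

lemma measurable_dualVar (hY : IsGaussianVAR P p A Sig Y ε) (l : ℕ) (a : Fin d) (t : ℤ) :
    Measurable (dualVar p A Sig Y l a t) := by
  have := fun t b => measurable_innov (p := p) (A := A) hY.measurable_Y t b
  unfold dualVar
  fun_prop

variable [IsProbabilityMeasure P]

/-- For `h < 0` every innovation in the dual variable is later than `Y_{t+h}`. For `h ≥ 0` the
recursion is substituted for `Y_{t+h}^c` and strong induction on `h` is used: among the lagged
values only `Y_t^a` contributes, giving `lagCoef p A h c a`, and for `h > 0` the innovation part
contributes its negative. -/
lemma hasMean_dualVar_mul_eval (hY : IsGaussianVAR P p A Sig Y ε) (l : ℕ) (a c : Fin d) {h : ℤ}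
    (hl : h < l) :
    HasMean P (fun t ω => dualVar p A Sig Y l a t ω * Y (t + h) ω c)
      (if h = 0 ∧ c = a then 1 else 0) := by
  have hneg : ∀ (h : ℤ), h < 0 → ∀ c,
      HasMean P (fun t ω => dualVar p A Sig Y l a t ω * Y (t + h) ω c) 0 := by
    intro h hh c
    have h1 := HasMean.sum (P := P) (I := Finset.range l)
      (F := fun m t ω => ∑ b, dualWeight p A Sig a m b *
        (innov p A Y (t + m) b ω * Y (t + m + (h - m)) ω c)) (C := fun m =>
          ∑ b, dualWeight p A Sig a m b * 0)
      fun m _ => HasMean.sum fun b _ =>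
        ((hY.hasMean_innov_mul_eval b c (h := h - m) (by omega)).shift m).const_mul _
    refine h1.congr (fun t ω => ?_) (by simp)
    simp only [dualVar, Finset.sum_mul]
    refine Finset.sum_congr rfl fun m _ => Finset.sum_congr rfl fun b _ => ?_
    rw [show t + m + (h - m) = t + h by ring, mul_assoc]
  rcases lt_or_ge h 0 with hh | hh
  · rw [if_neg fun hc => hh.ne hc.1]
    exact hneg h hh c
  obtain ⟨n, rfl⟩ := Int.eq_ofNat_of_zero_le hh
  have hn : n < l := by exact_mod_cast hl
  clear hl hh
  induction n using Nat.strong_induction_on generalizing c with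
  | _ n ih =>
  have hprev : ∀ m ∈ Finset.Icc 1 p, ∀ b, HasMean P
      (fun t ω => dualVar p A Sig Y l a t ω * Y (t + n - m) ω b)
        (if m = n ∧ b = a then 1 else 0) := by
    intro m hm b
    rw [Finset.mem_Icc] at hm
    rcases lt_or_ge n m with h | h
    · rw [if_neg (by omega)]
      refine (hneg ((n : ℤ) - m) (by omega) b).congr (fun t ω => ?_) rfl
      rw [add_sub_assoc]
    · refine (ih (n - m) (by omega) b (by omega)).congr (fun t ω => ?_) ?_
      · rw [add_sub_assoc, Nat.cast_sub h]
      · refine if_congr ?_ rfl rfl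
        rw [Nat.cast_eq_zero]
        exact and_congr_left fun _ => by omega
  have h1 := HasMean.sum (P := P) (I := Finset.range l)
      (F := fun m t ω => ∑ b, dualWeight p A Sig a m b *
        (innov p A Y (t + m) b ω * innov p A Y (t + n) c ω))
      (C := fun m => ∑ b, dualWeight p A Sig a m b * (if (m : ℤ) = n then Sig b c else 0))
      fun m _ => HasMean.sum fun b _ => (hY.hasMean_innov_mul_innov b c m n).const_mul _
  have h2 := HasMean.sum (P := P) (I := Finset.Icc 1 p)
      (F := fun m t ω => ∑ b, A m c b * (dualVar p A Sig Y l a t ω * Y (t + n - m) ω b))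
      (C := fun m => ∑ b, A m c b * (if m = n ∧ b = a then 1 else 0))
      fun m hm => HasMean.sum fun b _ => (hprev m hm b).const_mul _
  refine (h1.add h2).congr (fun t ω => ?_) ?_
  · rw [eval_eq_innov_add (p := p) (A := A) (Y := Y) (t + n) c ω, mul_add]
    congr 1
    · simp only [dualVar, Finset.sum_mul, mul_assoc]
    · simp only [Finset.mul_sum]
      exact Finset.sum_congr rfl fun m _ => Finset.sum_congr rfl fun b _ => by ring
  · have e1 : ∑ m ∈ Finset.range l, ∑ b, dualWeight p A Sig a m b *
        (if (m : ℤ) = n then Sig b c else 0) = ∑ b, dualWeight p A Sig a n b * Sig b c := by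
      rw [Finset.sum_eq_single n]
      · simp
      · intro m _ hm
        simp [hm]
      · intro h
        exact absurd (Finset.mem_range.2 hn) h
    have e2 : ∑ m ∈ Finset.Icc 1 p, ∑ b, A m c b * (if m = n ∧ b = a then 1 else 0) =
        lagCoef p A n c a := by
      by_cases hp : n ∈ Finset.Icc 1 p
      · rw [Finset.sum_eq_single_of_mem n hp, Finset.sum_eq_single a]
        · simp [show lagCoef p A n = A n from if_pos hp]
        · intro b _ hb
          simp [hb]
        · simp
        · intro m _ hm
          simp [hm]
      · rw [lagCoef, if_neg hp]
        refine Finset.sum_eq_zero fun m hm => Finset.sum_eq_zero fun b _ => ?_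
        rw [if_neg, mul_zero]
        rintro ⟨rfl, -⟩
        exact hp hm
    rw [e1, e2, sum_dualWeight_mul hY.posDef]
    rcases eq_or_ne n 0 with rfl | h0
    · simp [lagCoef]
    · simp [h0]

lemma exists_hasMean_dualVar_sq (hY : IsGaussianVAR P p A Sig Y ε) (l : ℕ) (a : Fin d) :
    ∃ K, HasMean P (fun t ω => dualVar p A Sig Y l a t ω ^ 2) K := by
  refine ⟨_, HasMean.congr (HasMean.sum (I := Finset.range l) fun m _ => HasMean.sum
    (I := Finset.univ) fun b _ => HasMean.sum (I := Finset.range l) fun m' _ => HasMean.sum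
    (I := Finset.univ) fun b' _ => (hY.hasMean_innov_mul_innov b b' m m').const_mul
      (dualWeight p A Sig a m b * dualWeight p A Sig a m' b')) (fun t ω => ?_) rfl⟩
  rw [pow_two, dualVar, Finset.sum_mul]
  refine Finset.sum_congr rfl fun m _ => ?_
  rw [Finset.sum_mul]
  refine Finset.sum_congr rfl fun b _ => ?_
  rw [Finset.mul_sum]
  refine Finset.sum_congr rfl fun m' _ => ?_
  rw [Finset.mul_sum]
  exact Finset.sum_congr rfl fun b' _ => by ring

lemma memLp_dualVar (hY : IsGaussianVAR P p A Sig Y ε) (l : ℕ) (a : Fin d) (t : ℤ) :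
    MemLp (dualVar p A Sig Y l a t) 2 P :=
  memLp_finsetSum _ fun _ _ => memLp_finsetSum _ fun b _ => (hY.memLp_innov _ b).const_mul _

lemma integral_dualVar (hY : IsGaussianVAR P p A Sig Y ε) (l : ℕ) (a : Fin d) (t : ℤ) :
    ∫ ω, dualVar p A Sig Y l a t ω ∂P = 0 := by
  have hi : ∀ s b, Integrable (innov p A Y s b) P := fun s b =>
    (hY.memLp_innov s b).integrable (by norm_num)
  simp only [dualVar]
  rw [integral_finsetSum _ fun m _ => integrable_finsetSum _ fun b _ => (hi _ b).const_mul _]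
  refine Finset.sum_eq_zero fun m _ => ?_
  rw [integral_finsetSum _ fun b _ => (hi _ b).const_mul _]
  refine Finset.sum_eq_zero fun b _ => ?_
  rw [integral_const_mul, hY.integral_innov, mul_zero]

/-- The dual variable is independent of the rest of the history. -/
lemma indepFun_dualVar (hY : IsGaussianVAR P p A Sig Y ε) (l : ℕ) (a : Fin d) (t : ℤ)
    {β : Type*} [MeasurableSpace β] {g : Ω → β}
    (hg : Measurable[historyWithout Y (t + l) (a, t)] g) :
    IndepFun (dualVar p A Sig Y l a t) g P := by
  let S := {w : Fin d × ℤ // w.2 < t + l ∧ w ≠ (a, t)}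
  -- The dual variable is a finite linear combination of the process, so adjoining it keeps joint
  -- Gaussianity; zero covariance with the rest of the history then gives independence.
  have hG : IsGaussianProcess (Sum.elim (fun (_ : Unit) => dualVar p A Sig Y l a t)
      (fun (w : S) ω => Y w.1.2 ω w.1.1)) P := by
    refine hY.isGaussianProcess.of_isGaussianProcess ?_
    rintro (_ | w)
    · obtain ⟨c, hc⟩ := (Finsupp.mem_span_range_iff_exists_finsupp).1
        (dualVar_mem_span (p := p) (A := A) (Sig := Sig) (Y := Y) l a t)
      let I : Finset (Fin d × ℤ) := c.support.map (Function.Embedding.subtype _)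
      refine ⟨I, ∑ w : I, (if h : w.1.2 < t + l then c ⟨w.1, h⟩ else 0) •
        ContinuousLinearMap.proj w, fun ω => ?_⟩
      have h1 := congrFun hc ω
      have h2 := Finset.sum_coe_sort I (fun w => (if h : w.2 < t + l then c ⟨w, h⟩ else 0) *
        Y w.2 ω w.1)
      rw [Finset.sum_map] at h2
      rw [Finsupp.sum, Finset.sum_apply] at h1
      simp only [Sum.elim_inl, ← h1, sum_apply]
      refine Eq.trans (Finset.sum_congr rfl fun w _ => ?_) h2.symm
      simp [w.2]
    · refine ⟨{w.1}, ContinuousLinearMap.proj ⟨w.1, by simp⟩, fun ω => ?_⟩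
      simp
  have hm : ∀ (w : Fin d × ℤ), Measurable fun ω => Y w.2 ω w.1 := fun w => by
    have := hY.measurable_Y w.2
    fun_prop
  have h := hG.indepFun_of_covariance_eq_zero
    (fun _ => (hY.measurable_dualVar l a t).aemeasurable) (fun w => (hm _).aemeasurable) (by
      intro _ w
      rw [covariance_eq_sub (hY.memLp_dualVar l a t) (hY.memLp_eval _ _), hY.integral_dualVar,
        zero_mul, sub_zero]
      have h1 := (hY.hasMean_dualVar_mul_eval l a w.1.1 (h := w.1.2 - t)
        (by have := w.2.1; omega)).mean t
      rw [add_sub_cancel, if_neg] at h1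
      · exact h1
      · rintro ⟨h2, h3⟩
        exact w.2.2 (Prod.ext h3 (by simpa using sub_eq_zero.1 h2)))
  have h2 : historyWithout Y (t + l) (a, t) ≤
      MeasurableSpace.comap (fun ω (w : S) => Y w.1.2 ω w.1.1) inferInstance := by
    refine iSup₂_le fun w hw => ?_
    have : Measurable (fun x : S → ℝ => x ⟨w, hw⟩) := measurable_pi_apply _
    exact (this.comp (comap_measurable (fun ω (w : S) => Y w.1.2 ω w.1.1))).comap_le
  have h3 := (IndepFun_iff_Indep _ _ _).1 (h.comp (φ := fun x => x ()) (by fun_prop) measurable_id)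
  rw [IndepFun_iff_Indep]
  exact indep_of_indep_of_le_right h3 (hg.comap_le.trans h2)

end IsGaussianVAR

end PLVAR

/-! ### Conditional independence and the support of the lag matrices. -/

namespace PLVAR

section Freezing

variable {Ω α : Type*} [MeasurableSpace Ω] [MeasurableSpace α] {P : Measure Ω}
  [IsProbabilityMeasure P]

/-- The two hypotheses amount to mutual independence of `e`, `V` and `H`; the product formula is
checked on rectangles. -/
lemma indepFun_prodMk_of_indepFun {H : Ω → α} {V e : Ω → ℝ} (hH : Measurable H)
    (hV : Measurable V) (he : Measurable e) (h1 : IndepFun e (fun ω => (V ω, H ω)) P)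
    (h2 : IndepFun V H P) : IndepFun H (fun ω => (V ω, e ω)) P := by
  rw [indepFun_iff_map_prod_eq_prod_map_map hH.aemeasurable (hV.prodMk he).aemeasurable]
  have h3 : IndepFun e V P := h1.comp measurable_id measurable_fst
  have hp1 : IsProbabilityMeasure (P.map fun ω => (H ω, V ω, e ω)) :=
    Measure.isProbabilityMeasure_map (hH.prodMk (hV.prodMk he)).aemeasurable
  have hp2 : IsProbabilityMeasure (P.map H) := Measure.isProbabilityMeasure_map hH.aemeasurable
  have hp3 : IsProbabilityMeasure (P.map fun ω => (V ω, e ω)) :=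
    Measure.isProbabilityMeasure_map (hV.prodMk he).aemeasurable
  refine Measure.ext_prod₃ fun {s t u} hs ht hu => ?_
  rw [Measure.map_apply (hH.prodMk (hV.prodMk he)) (hs.prod (ht.prod hu)), Measure.prod_prod,
    Measure.map_apply hH hs, Measure.map_apply (hV.prodMk he) (ht.prod hu)]
  have e1 : (fun ω => (H ω, V ω, e ω)) ⁻¹' s ×ˢ t ×ˢ u =
      e ⁻¹' u ∩ (fun ω => (V ω, H ω)) ⁻¹' t ×ˢ s := by
    ext ω
    simp only [Set.mem_preimage, Set.mem_prod, Set.mem_inter_iff]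
    tauto
  have e2 : (fun ω => (V ω, e ω)) ⁻¹' t ×ˢ u = e ⁻¹' u ∩ V ⁻¹' t := by
    ext ω
    simp only [Set.mem_preimage, Set.mem_prod, Set.mem_inter_iff]
    tauto
  have e3 : (fun ω => (V ω, H ω)) ⁻¹' t ×ˢ s = V ⁻¹' t ∩ H ⁻¹' s := by
    ext ω
    simp only [Set.mem_preimage, Set.mem_prod, Set.mem_inter_iff]
  rw [e1, h1.measure_inter_preimage_eq_mul _ _ hu (ht.prod hs), e3,
    h2.measure_inter_preimage_eq_mul _ _ ht hs, e2, h3.measure_inter_preimage_eq_mul _ _ hu ht]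
  ring

/-- Conditional expectations of functions of `H` and of a variable independent of `H`. -/
lemma condExp_comap_of_indepFun {β : Type*} [MeasurableSpace β] [StandardBorelSpace β] [Nonempty β]
    {H : Ω → α} {Z : Ω → β} (hH : Measurable H) (hZ : Measurable Z) (hind : IndepFun H Z P)
    {f : α × β → ℝ} (hf : StronglyMeasurable f) (hint : Integrable (fun ω => f (H ω, Z ω)) P) :
    P[fun ω => f (H ω, Z ω) | MeasurableSpace.comap H inferInstance] =ᵐ[P]
      fun ω => ∫ ω', f (H ω, Z ω') ∂P := by
  have h1 := condExp_prod_ae_eq_integral_condDistrib hH hZ.aemeasurable hf hint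
  have hp : IsProbabilityMeasure (P.map Z) := Measure.isProbabilityMeasure_map hZ.aemeasurable
  have h2 : condDistrib Z H P =ᵐ[P.map H] Kernel.const α (P.map Z) := by
    refine condDistrib_ae_eq_of_measure_eq_compProd H hZ.aemeasurable ?_
    rw [Measure.compProd_const]
    exact (indepFun_iff_map_prod_eq_prod_map_map hH.aemeasurable hZ.aemeasurable).1 hind
  refine h1.trans ?_
  filter_upwards [ae_of_ae_map hH.aemeasurable h2] with ω hω
  rw [hω, Kernel.const_apply, integral_map hZ.aemeasurable]
  exact (hf.comp_measurable measurable_prodMk_left).aestronglyMeasurable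

/-- If `X` and `W` depend on `H` and on the independent variables `V` and `e` in an affine way,
then they are conditionally independent given `H` iff `W` does not involve `V`. -/
lemma condIndepGiven_comap_iff {H : Ω → α} {V e X W : Ω → ℝ} {g₁ g₂ : α → ℝ} {r c : ℝ}
    (hH : Measurable H) (hV : Measurable V) (he : Measurable e)
    (hind : IndepFun H (fun ω => (V ω, e ω)) P) (hVe : IndepFun V e P)
    (hVL : MemLp V 2 P) (heL : MemLp e 2 P) (hV0 : ∫ ω, V ω ∂P = 0) (hV2 : ∫ ω, V ω ^ 2 ∂P ≠ 0)
    (hr : r ≠ 0) (hg₁ : Measurable g₁) (hg₂ : Measurable g₂)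
    (hX : ∀ ω, X ω = r * V ω + g₁ (H ω)) (hW : ∀ ω, W ω = c * V ω + e ω + g₂ (H ω)) :
    CondIndepGiven P (MeasurableSpace.comap H inferInstance) X W ↔ c = 0 := by
  -- Freezing: given `H`, the conditional law of `(X, W)` is its law over `(V, e)` with the value of
  -- `H` held fixed.
  have key : ∀ D : Set (ℝ × ℝ), MeasurableSet D →
      P⟦(fun ω => (X ω, W ω)) ⁻¹' D | MeasurableSpace.comap H inferInstance⟧ =ᵐ[P] fun ω =>
        P.real {ω' | (r * V ω' + g₁ (H ω), c * V ω' + e ω' + g₂ (H ω)) ∈ D} := by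
    intro D hD
    let f : α × ℝ × ℝ → ℝ :=
      ((fun x : α × ℝ × ℝ => (r * x.2.1 + g₁ x.1, c * x.2.1 + x.2.2 + g₂ x.1)) ⁻¹' D).indicator 1
    have hm : Measurable fun x : α × ℝ × ℝ => (r * x.2.1 + g₁ x.1, c * x.2.1 + x.2.2 + g₂ x.1) := by
      fun_prop
    have hf : Measurable f := measurable_one.indicator (hm hD)
    have e1 : ((fun ω => (X ω, W ω)) ⁻¹' D).indicator (fun _ => (1 : ℝ)) =
        fun ω => f (H ω, V ω, e ω) := by
      have : (fun ω => (X ω, W ω)) = fun ω => (r * V ω + g₁ (H ω), c * V ω + e ω + g₂ (H ω)) :=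
        funext fun ω => by rw [hX, hW]
      rw [this]
      rfl
    have hint : Integrable (fun ω => f (H ω, V ω, e ω)) P := by
      rw [← e1]
      refine (integrable_const (1 : ℝ)).indicator (MeasurableSet.preimage hD ?_)
      have : Measurable X := by rw [funext hX]; fun_prop
      have : Measurable W := by rw [funext hW]; fun_prop
      fun_prop
    rw [e1]
    refine (condExp_comap_of_indepFun hH (hV.prodMk he) hind hf.stronglyMeasurable hint).trans
      (ae_of_all _ fun ω => ?_)
    have hS : MeasurableSet
        {ω' | (r * V ω' + g₁ (H ω), c * V ω' + e ω' + g₂ (H ω)) ∈ D} :=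
      MeasurableSet.preimage hD (f := fun ω' =>
        (r * V ω' + g₁ (H ω), c * V ω' + e ω' + g₂ (H ω))) (by fun_prop)
    exact integral_indicator_one hS
  have key1 : ∀ B : Set ℝ, MeasurableSet B →
      P⟦X ⁻¹' B | MeasurableSpace.comap H inferInstance⟧ =ᵐ[P] fun ω =>
        P.real {ω' | r * V ω' + g₁ (H ω) ∈ B} := by
    intro B hB
    have := key (B ×ˢ Set.univ) (hB.prod MeasurableSet.univ)
    simpa only [Set.mem_prod, Set.mem_univ, and_true, Set.mk_preimage_prod, Set.preimage_univ,
      Set.inter_univ] using this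
  have key2 : ∀ C : Set ℝ, MeasurableSet C →
      P⟦W ⁻¹' C | MeasurableSpace.comap H inferInstance⟧ =ᵐ[P] fun ω =>
        P.real {ω' | c * V ω' + e ω' + g₂ (H ω) ∈ C} := by
    intro C hC
    have := key (Set.univ ×ˢ C) (MeasurableSet.univ.prod hC)
    simpa only [Set.mem_prod, Set.mem_univ, true_and, Set.mk_preimage_prod, Set.preimage_univ,
      Set.univ_inter] using this
  have key12 : ∀ B C : Set ℝ, MeasurableSet B → MeasurableSet C →
      P⟦X ⁻¹' B ∩ W ⁻¹' C | MeasurableSpace.comap H inferInstance⟧ =ᵐ[P] fun ω =>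
        P.real ((fun ω' => r * V ω' + g₁ (H ω)) ⁻¹' B ∩
          (fun ω' => c * V ω' + e ω' + g₂ (H ω)) ⁻¹' C) := by
    intro B C hB hC
    have := key (B ×ˢ C) (hB.prod hC)
    rw [Set.mk_preimage_prod] at this
    exact this
  constructor
  · intro h
    -- Restricting to rational half-lines leaves countably many null sets, so one `ω₀` works for all
    -- of them; these half-lines form a generating π-system, which makes the variables frozen at
    -- `ω₀` independent.
    have hall : ∀ᵐ ω ∂P, ∀ q q' : ℚ,
        P.real ((fun ω' => r * V ω' + g₁ (H ω)) ⁻¹' Set.Iic (q : ℝ) ∩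
          (fun ω' => c * V ω' + e ω' + g₂ (H ω)) ⁻¹' Set.Iic (q' : ℝ)) =
        P.real ((fun ω' => r * V ω' + g₁ (H ω)) ⁻¹' Set.Iic (q : ℝ)) *
          P.real ((fun ω' => c * V ω' + e ω' + g₂ (H ω)) ⁻¹' Set.Iic (q' : ℝ)) := by
      rw [ae_all_iff]
      intro q
      rw [ae_all_iff]
      intro q'
      filter_upwards [h _ _ (measurableSet_Iic (a := (q : ℝ))) (measurableSet_Iic (a := (q' : ℝ))),
        key12 _ _ (measurableSet_Iic (a := (q : ℝ))) (measurableSet_Iic (a := (q' : ℝ))),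
        key1 _ (measurableSet_Iic (a := (q : ℝ))), key2 _ (measurableSet_Iic (a := (q' : ℝ)))]
        with ω h0 h1 h2 h3
      rw [Pi.mul_apply, h1, h2, h3] at h0
      exact h0
    obtain ⟨ω₀, hω₀⟩ := hall.exists
    have hmX : Measurable fun ω' => r * V ω' + g₁ (H ω₀) := by fun_prop
    have hmW : Measurable fun ω' => c * V ω' + e ω' + g₂ (H ω₀) := by fun_prop
    have hXW : IndepFun (fun ω' => r * V ω' + g₁ (H ω₀))
        (fun ω' => c * V ω' + e ω' + g₂ (H ω₀)) P := by
      rw [IndepFun_iff_Indep]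
      refine IndepSets.indep (hmX.comap_le) (hmW.comap_le)
        (p1 := {s | ∃ t ∈ ⋃ a : ℚ, {Set.Iic (a : ℝ)}, (fun ω' => r * V ω' + g₁ (H ω₀)) ⁻¹' t = s})
        (p2 := {s | ∃ t ∈ ⋃ a : ℚ, {Set.Iic (a : ℝ)},
          (fun ω' => c * V ω' + e ω' + g₂ (H ω₀)) ⁻¹' t = s})
        (Real.isPiSystem_Iic_rat.comap _) (Real.isPiSystem_Iic_rat.comap _) ?_ ?_ ?_
      · rw [BorelSpace.measurable_eq (α := ℝ), Real.borel_eq_generateFrom_Iic_rat,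
          MeasurableSpace.comap_generateFrom]
        rfl
      · rw [BorelSpace.measurable_eq (α := ℝ), Real.borel_eq_generateFrom_Iic_rat,
          MeasurableSpace.comap_generateFrom]
        rfl
      · rw [IndepSets_iff]
        rintro _ _ ⟨t, ht, rfl⟩ ⟨t', ht', rfl⟩
        simp only [Set.mem_iUnion, Set.mem_singleton_iff] at ht ht'
        obtain ⟨q, rfl⟩ := ht
        obtain ⟨q', rfl⟩ := ht'
        have := hω₀ q q'
        rw [← ENNReal.toReal_eq_toReal_iff' (measure_ne_top _ _)
          (ENNReal.mul_ne_top (measure_ne_top _ _) (measure_ne_top _ _)), ENNReal.toReal_mul]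
        exact this
    have hXW' : IndepFun (fun ω => r * V ω) (fun ω => c * V ω + e ω) P := by
      have := hXW.comp (φ := fun x => x - g₁ (H ω₀)) (ψ := fun x => x - g₂ (H ω₀))
        (by fun_prop) (by fun_prop)
      simpa [Function.comp_def] using this
    have h1 := hXW'.integral_fun_mul_eq_mul_integral (by fun_prop) (by fun_prop)
    have h2 := hVe.integral_fun_mul_eq_mul_integral hVL.1 heL.1
    rw [integral_const_mul, hV0, mul_zero, zero_mul] at h1
    rw [hV0, zero_mul] at h2
    have hi : Integrable (fun ω => V ω * e ω) P := hVL.integrable_mul heL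
    -- The covariance of the frozen variables is `r c E[V²]`; independence makes it vanish, which
    -- forces `c = 0`.
    have h3 : ∫ ω, r * V ω * (c * V ω + e ω) ∂P = r * c * ∫ ω, V ω ^ 2 ∂P := by
      have : ∀ ω, r * V ω * (c * V ω + e ω) = r * c * V ω ^ 2 + r * (V ω * e ω) := fun ω => by ring
      simp_rw [this]
      rw [integral_add (hVL.integrable_sq.const_mul _) (hi.const_mul _), integral_const_mul,
        integral_const_mul, h2, mul_zero, add_zero]
    rw [h3] at h1
    simpa [hr, hV2] using h1
  · rintro rfl B C hB hC
    filter_upwards [key12 B C hB hC, key1 B hB, key2 C hC] with ω h1 h2 h3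
    rw [Pi.mul_apply, h1, h2, h3]
    have hi : IndepFun (fun ω' => r * V ω' + g₁ (H ω)) (fun ω' => 0 * V ω' + e ω' + g₂ (H ω)) P := by
      have := hVe.comp (φ := fun x => r * x + g₁ (H ω)) (ψ := fun x => 0 * 0 + x + g₂ (H ω))
        (by fun_prop) (by fun_prop)
      simpa [Function.comp_def] using this
    simp only [measureReal_def, hi.measure_inter_preimage_eq_mul _ _ hB hC, ENNReal.toReal_mul]
    rfl

end Freezing

variable {Ω : Type*} [MeasurableSpace Ω] {d p : ℕ} {A : ℕ → Matrix (Fin d) (Fin d) ℝ}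
  {Sig : Matrix (Fin d) (Fin d) ℝ} {Y ε : ℤ → Ω → EuclideanSpace ℝ (Fin d)}

namespace IsGaussianVAR

variable {P : Measure Ω} [IsProbabilityMeasure P]

/-- The dual variable is `V = κ Y_s^a + g` with `g` a function of the conditioning history. Solving
for `Y_s^a` and inserting the result in the recursion gives the affine form of
`condIndepGiven_comap_iff` with `r = κ⁻¹` and `c = lagCoef p A l i a * κ⁻¹`. -/
lemma condIndepGiven_iff (hY : IsGaussianVAR P p A Sig Y ε) (l : ℕ) (hl : 0 < l) (s : ℤ)
    (a i : Fin d) :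
    CondIndepGiven P (historyWithout Y (s + l) (a, s)) (fun ω => Y s ω a)
      (fun ω => Y (s + l) ω i) ↔ lagCoef p A l i a = 0 := by
  set V := dualVar p A Sig Y l a s with hVdef
  set e := innov p A Y (s + l) i with hedef
  have hVm : Measurable V := hY.measurable_dualVar l a s
  have hem : Measurable e := measurable_innov hY.measurable_Y _ _
  obtain ⟨κ, g, hg, hgV⟩ := exists_eq_mul_add_of_mem_span (v := (a, s))
    (dualVar_mem_span (p := p) (A := A) (Sig := Sig) (Y := Y) l a s)
  have hVX : ∫ ω, V ω * Y s ω a ∂P = 1 := by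
    have := (hY.hasMean_dualVar_mul_eval l a a (h := 0) (by exact_mod_cast hl)).mean s
    simpa using this
  have hV0 : ∫ ω, V ω ∂P = 0 := hY.integral_dualVar l a s
  have hV2 : ∫ ω, V ω ^ 2 ∂P ≠ 0 := by
    intro h0
    rw [integral_eq_zero_iff_of_nonneg (fun ω => sq_nonneg _)
      (hY.memLp_dualVar l a s).integrable_sq] at h0
    have : ∫ ω, V ω * Y s ω a ∂P = 0 := by
      rw [integral_eq_zero_of_ae]
      filter_upwards [h0] with ω hω
      have : V ω = 0 := by simpa using hω
      simp [this]
    rw [hVX] at this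
    exact one_ne_zero this
  -- If `κ = 0`, then `V` is a function of a history of which it is independent, so `E[V²] = E[V]² =
  -- 0`, contradicting `hV2`.
  have hκ : κ ≠ 0 := by
    rintro rfl
    have hVg : ∀ ω, g ω = V ω := fun ω => by
      have := hgV ω
      rw [zero_mul, zero_add] at this
      exact this.symm
    have h1 := (hY.indepFun_dualVar l a s hg).integral_fun_mul_eq_mul_integral
      hVm.aestronglyMeasurable (by rw [funext hVg]; exact hVm.aestronglyMeasurable)
    rw [hV0, zero_mul] at h1
    refine hV2 (Eq.trans (integral_congr_ae (ae_of_all _ fun ω => ?_)) h1)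
    simp only [hVg, pow_two]
    rfl
  obtain ⟨g', hg', hgW⟩ : ∃ g' : Ω → ℝ, Measurable[historyWithout Y (s + l) (a, s)] g' ∧
      ∀ ω, Y (s + l) ω i = lagCoef p A l i a * Y s ω a + e ω + g' ω := by
    refine ⟨fun ω => ∑ m ∈ Finset.Icc 1 p, ∑ b,
      if m = l ∧ b = a then 0 else A m i b * Y (s + l - m) ω b, ?_, fun ω => ?_⟩
    · refine Finset.measurable_sum _ fun m hm => Finset.measurable_sum _ fun b _ => ?_
      split_ifs with h
      · exact measurable_const
      · have := Finset.mem_Icc.1 hm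
        refine (measurable_historyWithout (by omega) ?_).const_mul _
        intro hv
        rw [Prod.mk.injEq] at hv
        exact h ⟨by omega, hv.1⟩
    · rw [eval_eq_innov_add (p := p) (A := A) (Y := Y) (s + l) i ω]
      have e1 : ∑ m ∈ Finset.Icc 1 p, ∑ b, (if m = l ∧ b = a then A m i b * Y (s + l - m) ω b
          else 0) = lagCoef p A l i a * Y s ω a := by
        by_cases hp : l ∈ Finset.Icc 1 p
        · rw [Finset.sum_eq_single_of_mem l hp, Finset.sum_eq_single a]
          · simp [show lagCoef p A l = A l from if_pos hp]
          · intro b _ hb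
            simp [hb]
          · simp
          · intro m _ hm
            simp [hm]
        · rw [lagCoef, if_neg hp, Matrix.zero_apply, zero_mul]
          refine Finset.sum_eq_zero fun m hm => Finset.sum_eq_zero fun b _ => ?_
          rw [if_neg]
          rintro ⟨rfl, -⟩
          exact hp hm
      rw [← e1, add_comm (Finset.sum _ _), add_assoc, ← Finset.sum_add_distrib]
      congr 1
      refine Finset.sum_congr rfl fun m _ => ?_
      rw [← Finset.sum_add_distrib]
      exact Finset.sum_congr rfl fun b _ => by split_ifs <;> simp
  have hle := past_le hY.measurable_Y (s + l)
  have hGle : historyWithout Y (s + l) (a, s) ≤ ‹MeasurableSpace Ω› :=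
    (historyWithout_le_past _ _).trans hle
  -- The conditioning variable `H` is the identity into `Ω` equipped with the smaller σ-algebra,
  -- whose comap is that σ-algebra itself; this is why the instances are explicit.
  have hid : @Measurable Ω Ω _ (historyWithout Y (s + l) (a, s)) id := measurable_id.mono hGle le_rfl
  have hidG : @Measurable Ω Ω (historyWithout Y (s + l) (a, s))
    (historyWithout Y (s + l) (a, s)) id := measurable_id
  have h1 : @IndepFun Ω ℝ Ω _ _ (historyWithout Y (s + l) (a, s)) V id P :=
    @indepFun_dualVar Ω d p A Sig Y ε _ P _ hY l a s Ω (historyWithout Y (s + l) (a, s)) id hidG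
  have h2 : @IndepFun Ω ℝ (ℝ × Ω) _ _ (@Prod.instMeasurableSpace _ _ _
      (historyWithout Y (s + l) (a, s))) e (fun ω => (V ω, ω)) P := by
    refine @indepFun_innov Ω d _ P p A Sig Y ε _ hY (s + l) ℝ (ℝ × Ω) _
      (@Prod.instMeasurableSpace _ _ _ (historyWithout Y (s + l) (a, s))) (fun v => v i) _
      (measurable_pi_apply i) ?_
    exact @Measurable.prodMk _ _ _ _ _ _ _ _ (measurable_past_dualVar l a s)
      (@Measurable.mono _ _ _ _ _ _ _ hidG (historyWithout_le_past _ _) le_rfl)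
  have h3 := @indepFun_prodMk_of_indepFun Ω Ω _ (historyWithout Y (s + l) (a, s)) P _ id V e hid
    hVm hem h2 h1
  have h4 : IndepFun V e P :=
    (hY.indepFun_innov (s + l) (f := fun v => v i) (measurable_pi_apply i)
      (measurable_past_dualVar (p := p) (A := A) (Sig := Sig) l a s)).symm
  have h5 := @condIndepGiven_comap_iff Ω Ω _ (historyWithout Y (s + l) (a, s)) P _ id V e
    (fun ω => Y s ω a) (fun ω => Y (s + l) ω i) (fun ω => -κ⁻¹ * g ω)
    (fun ω => g' ω - lagCoef p A l i a * κ⁻¹ * g ω) κ⁻¹ (lagCoef p A l i a * κ⁻¹)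
    hid hVm hem h3 h4 (hY.memLp_dualVar l a s) (hY.memLp_innov _ _) hV0 hV2 (inv_ne_zero hκ)
    (hg.const_mul _) (hg'.sub (hg.const_mul _))
    (fun ω => by
      rw [hVdef, hgV ω]
      simp only [id]
      field_simp
      ring)
    (fun ω => by
      rw [hgW ω, hVdef, hgV ω]
      simp only [id]
      field_simp
      ring)
  rw [MeasurableSpace.comap_id] at h5
  rw [h5]
  simp [hκ]

/-- The temporal Markov blanket consists of the nonzero autoregressive coefficients. -/
lemma mem_temporalMarkovBlanket_iff (hY : IsGaussianVAR P p A Sig Y ε) (t : ℤ) (i : Fin d)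
    (v : ℕ × Fin d) : v ∈ temporalMarkovBlanket P Y t i ↔ lagCoef p A v.1 i v.2 ≠ 0 := by
  obtain ⟨l, a⟩ := v
  change (t - (l : ℤ) < t ∧ ¬ CondIndepGiven P (historyWithout Y t (a, t - l))
    (fun ω => Y (t - l) ω a) (fun ω => Y t ω i)) ↔ _
  rcases Nat.eq_zero_or_pos l with rfl | hl
  · simp [lagCoef]
  · have h := hY.condIndepGiven_iff l hl (t - l) a i
    rw [sub_add_cancel] at h
    rw [h]
    simp [hl]

end IsGaussianVAR

end PLVAR

/-! ### Determinant ratios as residual sums of squares, and bounds for them. -/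

namespace PLVAR

section LeastSquares

variable {n d : ℕ} {Z : Matrix (Fin n) (ℕ × Fin d) ℝ} {s : Finset (ℕ × Fin d)} {x : ℕ × Fin d}

lemma scatterDet_eq (Z : Matrix (Fin n) (ℕ × Fin d) ℝ) (s : Finset (ℕ × Fin d)) :
    scatterDet Z s = ((Z.submatrix id (Subtype.val : s → ℕ × Fin d))ᵀ *
      Z.submatrix id (Subtype.val : s → ℕ × Fin d)).det := rfl

/-- The Schur complement formula for the determinant of a scatter matrix with one more column. -/
lemma scatterDet_insert (hx : x ∉ s) (hs : scatterDet Z s ≠ 0) :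
    scatterDet Z (insert x s) = scatterDet Z s *
      (Z.col x ⬝ᵥ Z.col x - ((Z.submatrix id (Subtype.val : s → ℕ × Fin d))ᵀ *ᵥ Z.col x) ⬝ᵥ
        ((Z.submatrix id (Subtype.val : s → ℕ × Fin d))ᵀ *
          Z.submatrix id (Subtype.val : s → ℕ × Fin d))⁻¹ *ᵥ
            ((Z.submatrix id (Subtype.val : s → ℕ × Fin d))ᵀ *ᵥ Z.col x)) := by
  set X := Z.submatrix id (Subtype.val : s → ℕ × Fin d) with hX
  let e : s ⊕ Unit ≃ (insert x s : Finset (ℕ × Fin d)) :=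
    (Equiv.optionEquivSumPUnit s).symm.trans (Finset.subtypeInsertEquivOption hx).symm
  have hdet : IsUnit (Xᵀ * X).det := isUnit_iff_ne_zero.2 hs
  have hinv : Invertible (Xᵀ * X) := (Xᵀ * X).invertibleOfIsUnitDet hdet
  have el : ∀ v : s, ((e (Sum.inl v) : (insert x s : Finset (ℕ × Fin d))) : ℕ × Fin d) = v :=
    fun v => rfl
  have er : ∀ u : Unit, ((e (Sum.inr u) : (insert x s : Finset (ℕ × Fin d))) : ℕ × Fin d) = x :=
    fun u => rfl
  have hblock : ((Zᵀ * Z).submatrix (fun v : (insert x s : Finset _) => (v : ℕ × Fin d))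
      (fun v : (insert x s : Finset _) => (v : ℕ × Fin d))).submatrix e e =
      Matrix.fromBlocks (Xᵀ * X) (Matrix.of fun v (_ : Unit) => (Xᵀ *ᵥ Z.col x) v)
        (Matrix.of fun (_ : Unit) v => (Xᵀ *ᵥ Z.col x) v)
        (Matrix.of fun (_ : Unit) (_ : Unit) => Z.col x ⬝ᵥ Z.col x) := by
    ext (u | u) (v | v)
    · rfl
    · rfl
    · simp only [Matrix.submatrix_apply, el, er, Matrix.fromBlocks_apply₂₁, Matrix.of_apply,
        Matrix.mul_apply, Matrix.mulVec, dotProduct, Matrix.transpose_apply]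
      exact Finset.sum_congr rfl fun j _ => mul_comm _ _
    · rfl
  rw [scatterDet, ← Matrix.det_submatrix_equiv_self e, hblock, Matrix.det_fromBlocks₁₁,
    scatterDet_eq, ← hX]
  congr 1
  rw [Matrix.det_unique, Matrix.sub_apply, Matrix.of_apply, Matrix.invOf_eq_nonsing_inv]
  congr 1
  rw [Matrix.mul_assoc]
  rfl

lemma posDef_scatter (h : ∀ γ : ℕ × Fin d → ℝ, (∃ v ∈ s, γ v ≠ 0) →
      0 < ∑ j, (∑ v ∈ s, γ v * Z j v) ^ 2) :
    ((Z.submatrix id (Subtype.val : s → ℕ × Fin d))ᵀ *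
      Z.submatrix id (Subtype.val : s → ℕ × Fin d)).PosDef := by
  classical
  refine Matrix.PosDef.of_dotProduct_mulVec_pos ?_ fun γ hγ => ?_
  · exact Matrix.isHermitian_conjTranspose_mul_self _
  · obtain ⟨v, hv⟩ := Function.ne_iff.1 hγ
    have h1 := h (fun w => if hw : w ∈ s then γ ⟨w, hw⟩ else 0) ⟨v, v.2, by simpa using hv⟩
    rw [star_trivial, ← Matrix.mulVec_mulVec, Matrix.dotProduct_mulVec, Matrix.vecMul_transpose]
    refine lt_of_lt_of_eq h1 (Eq.symm ?_)
    simp only [dotProduct, Matrix.mulVec]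
    refine Finset.sum_congr rfl fun j _ => ?_
    rw [pow_two, ← Finset.sum_coe_sort s]
    have : ∀ w : s, Z.submatrix id Subtype.val j w * γ w =
        (if hw : (w : ℕ × Fin d) ∈ s then γ ⟨w, hw⟩ else 0) * Z j w := fun w => by
      simp [mul_comm]
    simp only [this]

/-- Ratios of determinants of scatter matrices are residual sums of squares of least squares
regressions. -/
lemma scatterDet_insert_div (hx : x ∉ s)
    (h : ∀ γ : ℕ × Fin d → ℝ, (∃ v ∈ s, γ v ≠ 0) → 0 < ∑ j, (∑ v ∈ s, γ v * Z j v) ^ 2) :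
    (∃ β : ℕ × Fin d → ℝ, scatterDet Z (insert x s) / scatterDet Z s =
      ∑ j, (Z j x - ∑ v ∈ s, β v * Z j v) ^ 2) ∧
    ∀ β : ℕ × Fin d → ℝ, scatterDet Z (insert x s) / scatterDet Z s ≤
      ∑ j, (Z j x - ∑ v ∈ s, β v * Z j v) ^ 2 := by
  classical
  have hpd := posDef_scatter h
  have hs : scatterDet Z s ≠ 0 := hpd.det_pos.ne'
  rw [scatterDet_insert hx hs, mul_div_cancel_left₀ _ hs]
  set X := Z.submatrix id (Subtype.val : s → ℕ × Fin d) with hX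
  set z := Z.col x with hz
  set b := (Xᵀ * X)⁻¹ *ᵥ (Xᵀ *ᵥ z) with hb
  have hdet : IsUnit (Xᵀ * X).det := isUnit_iff_ne_zero.2 hs
  have hBb : (Xᵀ * X) *ᵥ b = Xᵀ *ᵥ z := by
    rw [hb, Matrix.mulVec_mulVec, Matrix.mul_nonsing_inv _ hdet, Matrix.one_mulVec]
  have hform : ∀ u v : s → ℝ, (X *ᵥ u) ⬝ᵥ (X *ᵥ v) = u ⬝ᵥ ((Xᵀ * X) *ᵥ v) := fun u v => by
    rw [← Matrix.mulVec_mulVec, Matrix.dotProduct_mulVec u, Matrix.vecMul_transpose]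
  have hzX : ∀ u : s → ℝ, z ⬝ᵥ (X *ᵥ u) = u ⬝ᵥ (Xᵀ *ᵥ z) := fun u => by
    rw [Matrix.dotProduct_mulVec u, Matrix.vecMul_transpose, dotProduct_comm]
  -- Completing the square at the solution `b` of the normal equations: the first two terms are the
  -- Schur complement, the last is nonnegative and vanishes at `u = b`.
  have key : ∀ u : s → ℝ, (z - X *ᵥ u) ⬝ᵥ (z - X *ᵥ u) =
      z ⬝ᵥ z - (Xᵀ *ᵥ z) ⬝ᵥ b + (u - b) ⬝ᵥ ((Xᵀ * X) *ᵥ (u - b)) := by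
    intro u
    have h1 : b ⬝ᵥ (Xᵀ * X) *ᵥ u = u ⬝ᵥ Xᵀ *ᵥ z := by
      rw [← hform, dotProduct_comm, hform, hBb]
    rw [sub_dotProduct, dotProduct_sub, dotProduct_sub, Matrix.mulVec_sub, sub_dotProduct,
      dotProduct_sub, dotProduct_sub, hform, hzX, dotProduct_comm (X *ᵥ u) z, hzX, h1, hBb,
      dotProduct_comm (Xᵀ *ᵥ z) b]
    ring
  have hrss : ∀ β : ℕ × Fin d → ℝ, ∑ j, (Z j x - ∑ v ∈ s, β v * Z j v) ^ 2 =
      (z - X *ᵥ fun v : s => β v) ⬝ᵥ (z - X *ᵥ fun v : s => β v) := by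
    intro β
    rw [dotProduct]
    refine Finset.sum_congr rfl fun j _ => ?_
    have : (X *ᵥ fun v : s => β v) j = ∑ v ∈ s, β v * Z j v := by
      rw [← Finset.sum_coe_sort s, Matrix.mulVec, dotProduct]
      exact Finset.sum_congr rfl fun v _ => mul_comm _ _
    rw [Pi.sub_apply, this, pow_two]
    rfl
  refine ⟨⟨fun w => if hw : w ∈ s then b ⟨w, hw⟩ else 0, ?_⟩, fun β => ?_⟩
  · have : (fun v : s => if hw : (v : ℕ × Fin d) ∈ s then b ⟨v, hw⟩ else 0) = b := by
      funext v
      simp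
    rw [hrss, this, key b]
    simp
  · rw [hrss, key]
    have := hpd.posSemidef.dotProduct_mulVec_nonneg ((fun v : s => β v) - b)
    rw [star_trivial] at this
    linarith

/-- Bounds for residual sums of squares in a linear regression with a well-conditioned design and
errors that are almost orthogonal to the regressors. -/
lemma residual_bounds {S mb mbTrue : Finset (ℕ × Fin d)} {e : Fin n → ℝ} {β₀ : ℕ × Fin d → ℝ}
    {c a : ℝ} (hc : 0 < c) (hn : 0 < n) (hx : x ∉ S) (hmb : mb ⊆ S)
    (hT : mbTrue ⊆ S) (hβ₀ : ∀ v ∈ S, v ∉ mbTrue → β₀ v = 0)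
    (hZ : ∀ j, Z j x = e j + ∑ v ∈ S, β₀ v * Z j v)
    (hdesign : ∀ γ : ℕ × Fin d → ℝ,
      c * n * ∑ v ∈ S, γ v ^ 2 ≤ ∑ j, (∑ v ∈ S, γ v * Z j v) ^ 2)
    (herr : ∑ v ∈ S, (∑ j, e j * Z j v) ^ 2 ≤ n * a) :
    scatterDet Z (insert x mbTrue) / scatterDet Z mbTrue ≤ ∑ j, e j ^ 2 ∧
    ∑ j, e j ^ 2 - a / c ≤ scatterDet Z (insert x mb) / scatterDet Z mb ∧
    ∀ v ∈ mbTrue, v ∉ mb → ∑ j, e j ^ 2 + c * n * β₀ v ^ 2 / 2 - 2 * a / c ≤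
      scatterDet Z (insert x mb) / scatterDet Z mb := by
  classical
  have hn' : (0 : ℝ) < n := by exact_mod_cast hn
  have hsub : ∀ t ⊆ S, ∀ (f : ℕ × Fin d → ℝ) (γ : ℕ × Fin d → ℝ),
      ∑ v ∈ S, (if v ∈ t then γ v else 0) * f v = ∑ v ∈ t, γ v * f v := by
    intro t ht f γ
    simp only [ite_mul, zero_mul]
    rw [← Finset.sum_filter, Finset.filter_mem_eq_inter, Finset.inter_eq_right.2 ht]
  have hpos : ∀ t ⊆ S, ∀ γ : ℕ × Fin d → ℝ, (∃ v ∈ t, γ v ≠ 0) →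
      0 < ∑ j, (∑ v ∈ t, γ v * Z j v) ^ 2 := by
    rintro t ht γ ⟨v, hv, hγ⟩
    have h1 := hdesign fun v => if v ∈ t then γ v else 0
    simp_rw [hsub t ht] at h1
    refine lt_of_lt_of_le (mul_pos (mul_pos hc hn') ?_) h1
    refine Finset.sum_pos' (fun w _ => sq_nonneg _) ⟨v, ht hv, ?_⟩
    rw [if_pos hv]
    positivity
  refine ⟨?_, ?_⟩
  · refine ((scatterDet_insert_div (fun h => hx (hT h)) (hpos mbTrue hT)).2 β₀).trans_eq ?_
    refine Finset.sum_congr rfl fun j _ => ?_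
    have : ∑ v ∈ S, β₀ v * Z j v = ∑ v ∈ mbTrue, β₀ v * Z j v := by
      refine (Finset.sum_subset hT fun v hv hv' => ?_).symm
      rw [hβ₀ v hv hv', zero_mul]
    rw [hZ j, this]
    ring
  · obtain ⟨β, hβ⟩ := (scatterDet_insert_div (fun h => hx (hmb h)) (hpos mb hmb)).1
    rw [hβ]
    -- The coefficient error, extended to all of `S`; at a true parent missing from `mb` it equals
    -- `β₀ v`.
    set γ : ℕ × Fin d → ℝ := fun v => β₀ v - if v ∈ mb then β v else 0 with hγ
    have hres : ∀ j, Z j x - ∑ v ∈ mb, β v * Z j v = e j + ∑ v ∈ S, γ v * Z j v := by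
      intro j
      simp only [hγ, sub_mul, Finset.sum_sub_distrib, hsub mb hmb]
      rw [hZ j]
      ring
    have hexp : ∑ j, (Z j x - ∑ v ∈ mb, β v * Z j v) ^ 2 = ∑ j, e j ^ 2 +
        ∑ v ∈ S, 2 * (γ v * ∑ j, e j * Z j v) + ∑ j, (∑ v ∈ S, γ v * Z j v) ^ 2 := by
      have h1 : ∑ v ∈ S, 2 * (γ v * ∑ j, e j * Z j v) =
          ∑ j, 2 * e j * ∑ v ∈ S, γ v * Z j v := by
        simp only [Finset.mul_sum]
        rw [Finset.sum_comm]
        exact Finset.sum_congr rfl fun j _ => Finset.sum_congr rfl fun v _ => by ring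
      rw [h1, ← Finset.sum_add_distrib, ← Finset.sum_add_distrib]
      exact Finset.sum_congr rfl fun j _ => by rw [hres]; ring
    -- Weighted AM–GM for the cross term. With `θ = 1` the design bound absorbs it completely; with
    -- `θ = 1 / 2` half of the design bound is left over, and it contains the contribution of a
    -- missing parent.
    have hcross : ∀ θ : ℝ, 0 < θ → -(c * n * θ * ∑ v ∈ S, γ v ^ 2) - a / (c * θ) ≤
        ∑ v ∈ S, 2 * (γ v * ∑ j, e j * Z j v) := by
      intro θ hθ
      have h1 : ∑ v ∈ S, (-(c * n * θ * γ v ^ 2) - (∑ j, e j * Z j v) ^ 2 / (c * n * θ)) ≤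
          ∑ v ∈ S, 2 * (γ v * ∑ j, e j * Z j v) := by
        refine Finset.sum_le_sum fun v _ => ?_
        set w := ∑ j, e j * Z j v
        have hk : 0 < c * n * θ := by positivity
        have : 0 ≤ (c * n * θ * γ v + w) ^ 2 / (c * n * θ) := by positivity
        have e2 : (c * n * θ * γ v + w) ^ 2 / (c * n * θ) =
            c * n * θ * γ v ^ 2 + 2 * (γ v * w) + w ^ 2 / (c * n * θ) := by
          field_simp
          ring
        linarith
      rw [Finset.sum_sub_distrib, Finset.sum_neg_distrib, ← Finset.mul_sum, ← Finset.sum_div] at h1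
      have h2 : (∑ v ∈ S, (∑ j, e j * Z j v) ^ 2) / (c * n * θ) ≤ a / (c * θ) := by
        rw [div_le_div_iff₀ (by positivity) (by positivity)]
        calc _ ≤ n * a * (c * θ) := by gcongr
          _ = _ := by ring
      linarith
    have hd := hdesign γ
    refine ⟨?_, fun v hv hv' => ?_⟩
    · have := hcross 1 one_pos
      rw [mul_one, mul_one] at this
      rw [hexp]
      linarith
    · have h1 := hcross (1 / 2) (by norm_num)
      have h2 : β₀ v ^ 2 ≤ ∑ v ∈ S, γ v ^ 2 := by
        have := Finset.single_le_sum (f := fun v => γ v ^ 2) (fun w _ => sq_nonneg _) (hT hv)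
        simpa [hγ, hv'] using this
      have h3 : c * n * β₀ v ^ 2 ≤ c * n * ∑ v ∈ S, γ v ^ 2 := by gcongr
      have h4 : a / (c * (1 / 2)) = 2 * a / c := by
        field_simp
      rw [h4] at h1
      rw [hexp]
      linarith

end LeastSquares

/-! ### Deterministic asymptotics of the score. -/

section Score

/-- The local score as a function of the number of rows, of the number of candidate parents and of
the residual sum of squares. -/
noncomputable def fmplScore (n : ℝ) (p : ℕ) (R : ℝ) : ℝ :=
  Real.pi ^ (-(n - 1) / 2) * (Real.Gamma ((n + p) / 2) / Real.Gamma (((p : ℝ) + 1) / 2))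
    * n ^ (-(2 * (p : ℝ) + 1) / 2) * R ^ (-(n - 1) / 2)

lemma fmplScore_pos {n : ℝ} (hn : 0 < n) (p : ℕ) {R : ℝ} (hR : 0 < R) : 0 < fmplScore n p R := by
  have h1 : 0 < Real.Gamma ((n + p) / 2) := Real.Gamma_pos_of_pos (by positivity)
  have h2 : 0 < Real.Gamma (((p : ℝ) + 1) / 2) := Real.Gamma_pos_of_pos (by positivity)
  have := Real.pi_pos
  unfold fmplScore
  positivity

lemma log_fmplScore {n : ℝ} (hn : 0 < n) (p : ℕ) {R : ℝ} (hR : 0 < R) :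
    Real.log (fmplScore n p R) = -(n - 1) / 2 * Real.log Real.pi +
      (Real.log (Real.Gamma ((n + p) / 2)) - Real.log (Real.Gamma (((p : ℝ) + 1) / 2))) +
      -(2 * (p : ℝ) + 1) / 2 * Real.log n + -(n - 1) / 2 * Real.log R := by
  have h1 : 0 < Real.Gamma ((n + p) / 2) := Real.Gamma_pos_of_pos (by positivity)
  have h2 : 0 < Real.Gamma (((p : ℝ) + 1) / 2) := Real.Gamma_pos_of_pos (by positivity)
  have := Real.pi_pos
  unfold fmplScore
  rw [Real.log_mul (by positivity) (by positivity), Real.log_mul (by positivity) (by positivity),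
    Real.log_mul (by positivity) (by positivity), Real.log_div h1.ne' h2.ne',
    Real.log_rpow Real.pi_pos, Real.log_rpow hn, Real.log_rpow hR]

/-- Log-convexity of Gamma at the midpoint of `x` and `x + 1`. -/
lemma log_Gamma_add_half_le {x : ℝ} (hx : 0 < x) :
    Real.log (Real.Gamma (x + 1 / 2)) ≤ Real.log (Real.Gamma x) + 1 / 2 * Real.log x := by
  have h := Real.convexOn_log_Gamma.2 (Set.mem_Ioi.2 hx) (Set.mem_Ioi.2 (by linarith : 0 < x + 1))
    (by norm_num : (0 : ℝ) ≤ 1 / 2) (by norm_num : (0 : ℝ) ≤ 1 / 2) (by norm_num)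
  have e : (1 / 2 : ℝ) • x + (1 / 2 : ℝ) • (x + 1) = x + 1 / 2 := by
    simp only [smul_eq_mul]; ring
  rw [e] at h
  simp only [Function.comp_apply, smul_eq_mul] at h
  rw [Real.Gamma_add_one hx.ne', Real.log_mul hx.ne' (Real.Gamma_pos_of_pos hx).ne'] at h
  linarith

/-- Each parent gains at most `(log n) / 2` from the Gamma factor, against a loss of `log n` from
the power of `n`. The constant `1/2` is what makes the net penalty positive. -/
lemma log_Gamma_half_add_le {n : ℝ} (p m : ℕ) (hn : 0 < n) (h : (p : ℝ) + m ≤ n) :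
    Real.log (Real.Gamma ((n + (p + m : ℕ)) / 2)) ≤
      Real.log (Real.Gamma ((n + p) / 2)) + m / 2 * Real.log n := by
  induction m with
  | zero => simp
  | succ m ih =>
    push_cast at h ih ⊢
    have h1 := ih (by linarith)
    have h2 := log_Gamma_add_half_le (x := (n + (p + m)) / 2) (by positivity)
    have h3 : Real.log ((n + (p + m)) / 2) ≤ Real.log n :=
      Real.log_le_log (by positivity) (by linarith)
    rw [show (n + (p + m)) / 2 + 1 / 2 = (n + ((p : ℝ) + (m + 1))) / 2 by ring] at h2
    linarith

/-- A model with too many parents has a smaller score, if the gain in the residual sum of squares is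
small. -/
lemma eventually_fmplScore_lt_of_lt {p p' : ℕ} (hp : p' < p) :
    ∀ᶠ n : ℕ in atTop, ∀ R R' : ℝ, 0 < R → 0 < R' →
      n * (Real.log R' - Real.log R) ≤ Real.log n / 2 →
      fmplScore n p R < fmplScore n p' R' := by
  obtain ⟨m, rfl⟩ := Nat.exists_eq_add_of_lt hp
  set C : ℝ := Real.log (Real.Gamma (((p' : ℝ) + 1) / 2)) -
    Real.log (Real.Gamma ((((p' + m + 1 : ℕ) : ℝ) + 1) / 2)) with hC
  have hlog : Tendsto (fun n : ℕ => Real.log n) atTop atTop :=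
    Real.tendsto_log_atTop.comp tendsto_natCast_atTop_atTop
  -- The net penalty is at least `(log n) / 2` and the gain in fit at most `(log n) / 4`; the
  -- difference must exceed the constant `C`.
  filter_upwards [hlog.eventually_gt_atTop (4 * C), eventually_ge_atTop (p' + (m + 1) + 1),
    hlog.eventually_ge_atTop 0] with n h1 h2 h0 R R' hR hR' h3
  have hn : (0 : ℝ) < n := by
    have : 0 < n := by omega
    exact_mod_cast this
  have hn1 : (1 : ℝ) ≤ n := by
    have : 1 ≤ n := by omega
    exact_mod_cast this
  have h4 := log_Gamma_half_add_le p' (m + 1) hn (by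
    have : p' + (m + 1) ≤ n := by omega
    exact_mod_cast this)
  rw [← add_assoc] at h4
  rw [← Real.log_lt_log_iff (fmplScore_pos hn _ hR) (fmplScore_pos hn _ hR'),
    log_fmplScore hn _ hR, log_fmplScore hn _ hR']
  have h5 : (n - 1) / 2 * (Real.log R' - Real.log R) ≤ Real.log n / 4 := by
    rcases le_or_gt (Real.log R' - Real.log R) 0 with h | h
    · have := mul_nonneg (show (0 : ℝ) ≤ (n - 1) / 2 by linarith) (neg_nonneg.2 h)
      linarith
    · linarith
  have h6 : (0 : ℝ) ≤ m * Real.log n := by positivity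
  push_cast at h4 hC ⊢
  linarith

/-- A model with a larger residual sum of squares, by a fixed factor, has a smaller score. -/
lemma eventually_fmplScore_lt_of_log_le (p p' : ℕ) {κ : ℝ} (hκ : 0 < κ) :
    ∀ᶠ n : ℕ in atTop, ∀ R R' : ℝ, 0 < R → 0 < R' → κ ≤ Real.log R - Real.log R' →
      fmplScore n p R < fmplScore n p' R' := by
  set C : ℝ := Real.log (Real.Gamma (((p' : ℝ) + 1) / 2)) -
    Real.log (Real.Gamma (((p : ℝ) + 1) / 2)) with hC
  have hlog : Tendsto (fun n : ℕ => Real.log n) atTop atTop :=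
    Real.tendsto_log_atTop.comp tendsto_natCast_atTop_atTop
  -- The fit separates the log scores by at least `κ (n - 1) / 2`, while the remaining terms are
  -- logarithmic in `n`; the summand `κ / 2` accounts for `n - 1` in place of `n`.
  have hlin : Tendsto (fun n : ℕ => (C + κ / 2 + ((p' : ℝ) + p) * Real.log n) / n) atTop (𝓝 0) := by
    have h1 : Tendsto (fun n : ℕ => Real.log n / n) atTop (𝓝 0) :=
      Real.isLittleO_log_id_atTop.tendsto_div_nhds_zero.comp tendsto_natCast_atTop_atTop
    have h2 := (tendsto_const_div_atTop_nhds_zero_nat (C + κ / 2)).add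
      (h1.const_mul ((p' : ℝ) + p))
    rw [mul_zero, add_zero] at h2
    refine h2.congr fun n => ?_
    ring
  filter_upwards [hlin.eventually (gt_mem_nhds (show 0 < κ / 2 by linarith)),
    eventually_ge_atTop (p' + p + 4), hlog.eventually_ge_atTop 0] with n h1 h2 h0 R R' hR hR' h3
  have hn4 : (4 : ℝ) ≤ n := by
    have : 4 ≤ n := by omega
    exact_mod_cast this
  have hn : (0 : ℝ) < n := by linarith
  rw [div_lt_iff₀ hn] at h1
  rw [← Real.log_lt_log_iff (fmplScore_pos hn _ hR) (fmplScore_pos hn _ hR'),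
    log_fmplScore hn _ hR, log_fmplScore hn _ hR']
  have h4 : Real.log (Real.Gamma ((n + p) / 2)) ≤
      Real.log (Real.Gamma ((n + p') / 2)) + p / 2 * Real.log n := by
    have h5 := log_Gamma_half_add_le 0 p hn (by
      have : 0 + p ≤ n := by omega
      exact_mod_cast this)
    have h6 : Real.log (Real.Gamma ((n + (0 : ℕ)) / 2)) ≤ Real.log (Real.Gamma ((n + p') / 2)) := by
      refine Real.log_le_log (Real.Gamma_pos_of_pos (by positivity)) ?_
      have hp' : (0 : ℝ) ≤ p' := by positivity
      -- Gamma increases on `[2, ∞)`, which is where `n ≥ 4` is needed.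
      refine Real.Gamma_strictMonoOn_Ici.monotoneOn ?_ ?_ ?_
      · simp only [Set.mem_Ici, Nat.cast_zero]; linarith
      · simp only [Set.mem_Ici]; linarith
      · simp only [Nat.cast_zero]; linarith
    rw [zero_add] at h5
    linarith
  have h5 : (n - 1) / 2 * κ ≤ (n - 1) / 2 * (Real.log R - Real.log R') :=
    mul_le_mul_of_nonneg_left h3 (by linarith)
  have h6 : (0 : ℝ) ≤ p * Real.log n := by positivity
  linarith

end Score

end PLVAR

/-! ### Conditioning of the design and comparison of the random scores. -/

namespace PLVAR

/-- A design matrix is well conditioned if its columns admit an approximately dual family of bounded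
vectors. -/
lemma design_lower_bound {n : ℕ} {ι : Type*} [DecidableEq ι] {S : Finset ι} {Z : Fin n → ι → ℝ}
    {V : ι → Fin n → ℝ} {K : ℝ} (hK : 0 ≤ K) (hn : 0 < n) (hV : ∀ u ∈ S, ∑ j, V u j ^ 2 ≤ K * n)
    (hVZ : ∀ u ∈ S, ∀ v ∈ S,
      |(∑ j, V u j * Z j v) / n - if u = v then 1 else 0| ≤ 1 / (2 * (S.card + 1)))
    (γ : ι → ℝ) :
    1 / (4 * (S.card + 1) * (K + 1)) * n * ∑ v ∈ S, γ v ^ 2 ≤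
      ∑ j, (∑ v ∈ S, γ v * Z j v) ^ 2 := by
  have hn' : (0 : ℝ) < n := by exact_mod_cast hn
  set T := ∑ v ∈ S, γ v ^ 2 with hT
  set Q := ∑ j, (∑ v ∈ S, γ v * Z j v) ^ 2 with hQ
  have hT0 : 0 ≤ T := Finset.sum_nonneg fun _ _ => sq_nonneg _
  have hQ0 : 0 ≤ Q := Finset.sum_nonneg fun _ _ => sq_nonneg _
  set s : ℝ := (S.card : ℝ) with hs
  have hs0 : 0 ≤ s := by positivity
  -- Pairing `V u` with the fitted combination recovers `n * γ u` up to the duality error, and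
  -- Cauchy–Schwarz bounds the pairing by `K n Q`. After summation over `u`, the tolerance `1 / (2
  -- (|S| + 1))` keeps the error below half of `n² T`, so the left side absorbs it.
  have h1 : ∀ u ∈ S, (n * γ u) ^ 2 ≤ 2 * (K * n * Q) + 2 * (n ^ 2 * (T * (s / (2 * (s + 1)) ^ 2))) := by
    intro u hu
    set D : ι → ℝ := fun v => (∑ j, V u j * Z j v) / n - if u = v then 1 else 0 with hD
    have e1 : ∑ j, V u j * ∑ v ∈ S, γ v * Z j v = n * γ u + n * ∑ v ∈ S, γ v * D v := by
      have e2 : ∑ v ∈ S, γ v * D v = (∑ v ∈ S, γ v * ∑ j, V u j * Z j v) / n - γ u := by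
        simp only [hD, mul_sub, Finset.sum_sub_distrib, mul_ite, mul_one, mul_zero,
          Finset.sum_ite_eq, if_pos hu, Finset.sum_div, mul_div_assoc]
      have e3 : ∑ v ∈ S, γ v * ∑ j, V u j * Z j v = ∑ j, V u j * ∑ v ∈ S, γ v * Z j v := by
        simp only [Finset.mul_sum]
        rw [Finset.sum_comm]
        exact Finset.sum_congr rfl fun j _ => Finset.sum_congr rfl fun v _ => by ring
      rw [e2, e3]
      field_simp
      ring
    have h2 : (∑ j, V u j * ∑ v ∈ S, γ v * Z j v) ^ 2 ≤ K * n * Q :=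
      (Finset.sum_mul_sq_le_sq_mul_sq _ _ _).trans (mul_le_mul_of_nonneg_right (hV u hu) hQ0)
    have h3 : (∑ v ∈ S, γ v * D v) ^ 2 ≤ T * (s / (2 * (s + 1)) ^ 2) := by
      refine (Finset.sum_mul_sq_le_sq_mul_sq _ _ _).trans (mul_le_mul_of_nonneg_left ?_ hT0)
      calc ∑ v ∈ S, D v ^ 2 ≤ ∑ v ∈ S, (1 / (2 * (s + 1))) ^ 2 := by
            refine Finset.sum_le_sum fun v hv => ?_
            rw [← sq_abs]
            exact pow_le_pow_left₀ (abs_nonneg _) (hVZ u hu v hv) 2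
        _ = s / (2 * (s + 1)) ^ 2 := by
            rw [Finset.sum_const, nsmul_eq_mul, one_div, inv_pow]
            rfl
    have e4 : n * γ u = ∑ j, V u j * ∑ v ∈ S, γ v * Z j v - n * ∑ v ∈ S, γ v * D v := by
      rw [e1]; ring
    have h5 : (n : ℝ) ^ 2 * (∑ v ∈ S, γ v * D v) ^ 2 ≤ n ^ 2 * (T * (s / (2 * (s + 1)) ^ 2)) := by
      gcongr
    rw [e4]
    nlinarith [sq_nonneg (∑ j, V u j * ∑ v ∈ S, γ v * Z j v + n * ∑ v ∈ S, γ v * D v)]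
  have h2 : (n : ℝ) ^ 2 * T ≤
      s * (2 * (K * n * Q) + 2 * (n ^ 2 * (T * (s / (2 * (s + 1)) ^ 2)))) := by
    have := Finset.sum_le_sum h1
    rw [Finset.sum_const, nsmul_eq_mul] at this
    refine le_trans (le_of_eq ?_) this
    rw [hT, Finset.mul_sum]
    exact Finset.sum_congr rfl fun v _ => by ring
  have h3 : s * (s / (2 * (s + 1)) ^ 2) ≤ 1 / 4 := by
    rw [← mul_div_assoc, div_le_div_iff₀ (by positivity) (by norm_num)]
    nlinarith
  have h4 : (n : ℝ) ^ 2 * T * (s * (s / (2 * (s + 1)) ^ 2)) ≤ n ^ 2 * T * (1 / 4) :=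
    mul_le_mul_of_nonneg_left h3 (by positivity)
  have h5 : (n : ℝ) * (n * T) ≤ n * (4 * (s * K * Q)) := by nlinarith
  have h6 : n * T ≤ 4 * (s * K * Q) := le_of_mul_le_mul_left h5 hn'
  rw [mul_assoc, one_div, inv_mul_le_iff₀ (by positivity)]
  have h7 : s * K * Q ≤ (s + 1) * (K + 1) * Q := by gcongr <;> linarith
  linarith

variable {Ω : Type*} {d p : ℕ} {A : ℕ → Matrix (Fin d) (Fin d) ℝ}
  {Sig : Matrix (Fin d) (Fin d) ℝ} {Y ε : ℤ → Ω → EuclideanSpace ℝ (Fin d)}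

/-- The autoregressive equation in terms of the lagged nodes. -/
lemma eval_eq_innov_add_sum_laggedNodes {k : ℕ} {i : Fin d}
    (hk : ∀ l a, k < l → lagCoef p A l i a = 0) (t : ℤ) (ω : Ω) :
    Y t ω i = innov p A Y t i ω +
      ∑ v ∈ laggedNodes d k, lagCoef p A v.1 i v.2 * Y (t - v.1) ω v.2 := by
  rw [eval_eq_innov_add (p := p) (A := A) t i ω, laggedNodes, Finset.sum_product]
  congr 1
  have h1 : ∑ m ∈ Finset.Icc 1 k, ∑ b, lagCoef p A m i b * Y (t - m) ω b =
      ∑ m ∈ Finset.Icc 1 (max p k), ∑ b, lagCoef p A m i b * Y (t - m) ω b := by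
    refine Finset.sum_subset (Finset.Icc_subset_Icc_right (le_max_right _ _)) fun m hm hm' => ?_
    refine Finset.sum_eq_zero fun b _ => ?_
    rw [hk, zero_mul]
    simp only [Finset.mem_Icc] at hm hm'
    omega
  have h2 : ∑ m ∈ Finset.Icc 1 p, ∑ b, lagCoef p A m i b * Y (t - m) ω b =
      ∑ m ∈ Finset.Icc 1 (max p k), ∑ b, lagCoef p A m i b * Y (t - m) ω b := by
    refine Finset.sum_subset (Finset.Icc_subset_Icc_right (le_max_left _ _)) fun m hm hm' => ?_
    refine Finset.sum_eq_zero fun b _ => ?_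
    rw [lagCoef, if_neg hm', Matrix.zero_apply, zero_mul]
  rw [h1, ← h2]
  exact Finset.sum_congr rfl fun m hm => by rw [lagCoef, if_pos hm]

variable [MeasurableSpace Ω]

lemma coe_filter_lagCoef_eq_temporalMarkovBlanket {P : Measure Ω} [IsProbabilityMeasure P]
    (hY : IsGaussianVAR P p A Sig Y ε) {k : ℕ} (t : ℤ) (i : Fin d)
    (hk : ∀ l a, k < l → lagCoef p A l i a = 0) :
    (((laggedNodes d k).filter fun v => lagCoef p A v.1 i v.2 ≠ 0 : Finset (ℕ × Fin d)) :
      Set (ℕ × Fin d)) = temporalMarkovBlanket P Y t i := by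
  ext v
  rw [hY.mem_temporalMarkovBlanket_iff, Finset.coe_filter, Set.mem_ofPred_eq]
  refine ⟨fun h => h.2, fun h => ⟨?_, h⟩⟩
  rw [laggedNodes, Finset.mem_product, Finset.mem_Icc]
  refine ⟨⟨?_, ?_⟩, Finset.mem_univ _⟩
  · by_contra hc
    have : v.1 = 0 := by omega
    exact h (by simp [lagCoef, this])
  · by_contra hc
    exact h (hk _ _ (by omega))

lemma lagCoef_eq_zero_of_trueLagLength_le {k : ℕ} (hk : trueLagLength p A ≤ k) (l : ℕ) (hl : k < l) :
    lagCoef p A l = 0 := by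
  rw [lagCoef]
  split_ifs with h
  · by_contra hc
    classical
    have h1 : id l ≤ trueLagLength p A := by
      unfold trueLagLength
      exact Finset.le_sup (f := id) (Finset.mem_filter.2 ⟨h, hc⟩)
    have h2 : l ≤ k := h1.trans hk
    omega
  · rfl

/-- The columns of the lagged data matrix, with a given number of rows. -/
def laggedRows (Y : ℤ → Ω → EuclideanSpace ℝ (Fin d)) (k n : ℕ) (ω : Ω) :
    Matrix (Fin n) (ℕ × Fin d) ℝ :=
  Matrix.of fun j v => Y ((k : ℤ) - v.1 + 1 + j) ω v.2

namespace IsGaussianVAR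

variable {P : Measure Ω} [IsProbabilityMeasure P]

/-- The lagged data matrix is well conditioned with probability tending to one. -/
lemma exists_eventually_design (hY : IsGaussianVAR P p A Sig Y ε) (k : ℕ) :
    ∃ c : ℝ, 0 < c ∧ ∀ᶠ q in probFilter P, ∀ γ : ℕ × Fin d → ℝ,
      c * q.1 * ∑ v ∈ laggedNodes d k, γ v ^ 2 ≤
        ∑ j, (∑ v ∈ laggedNodes d k, γ v * laggedRows Y k q.1 q.2 j v) ^ 2 := by
  set S := laggedNodes d k with hS
  choose K hK using fun u : ℕ × Fin d =>
    hY.exists_hasMean_dualVar_sq (A := A) (Sig := Sig) u.1 u.2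
  let B : ℝ := ∑ u ∈ S, |K u| + 1
  have hB : 0 ≤ B := by positivity
  refine ⟨1 / (4 * (S.card + 1) * (B + 1)), by positivity, ?_⟩
  have hpos : ∀ᶠ q : ℕ × Ω in probFilter P, 0 < q.1 :=
    (tendsto_fst_probFilter P).eventually (eventually_gt_atTop 0)
  have h1 : ∀ᶠ q : ℕ × Ω in probFilter P, ∀ u ∈ S,
      (∑ j ∈ Finset.range q.1,
        dualVar p A Sig Y u.1 u.2 ((k : ℤ) - u.1 + 1 + j) q.2 ^ 2) / q.1 < B := by
    rw [Filter.eventually_all_finset]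
    intro u hu
    refine ((hK u).lln _).eventually (gt_mem_nhds ?_)
    have := Finset.single_le_sum (f := fun u => |K u|) (fun w _ => abs_nonneg _) hu
    have h2 := le_abs_self (K u)
    linarith
  have h2 : ∀ᶠ q : ℕ × Ω in probFilter P, ∀ u ∈ S, ∀ v ∈ S,
      |(∑ j ∈ Finset.range q.1, dualVar p A Sig Y u.1 u.2 ((k : ℤ) - u.1 + 1 + j) q.2 *
        Y ((k : ℤ) - v.1 + 1 + j) q.2 v.2) / q.1 - if u = v then 1 else 0| <
          1 / (2 * (S.card + 1)) := by
    rw [Filter.eventually_all_finset]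
    intro u hu
    rw [Filter.eventually_all_finset]
    intro v hv
    have hv1 : 1 ≤ v.1 := (Finset.mem_Icc.1 (Finset.mem_product.1 hv).1).1
    -- The dual variable of column `u` in row `j` uses innovations at times `k - u.1 + 1 + j, …, k +
    -- j`. Column `v` sits at offset `u.1 - v.1`, which is below the window length `u.1` because
    -- `v.1 ≥ 1`.
    have h := (hY.hasMean_dualVar_mul_eval u.1 u.2 v.2 (h := (u.1 : ℤ) - v.1) (by omega)).lln
      ((k : ℤ) - u.1 + 1)
    have h' := (Metric.tendsto_nhds.1 h) (1 / (2 * (S.card + 1))) (by positivity)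
    filter_upwards [h'] with q hq
    rw [Real.dist_eq] at hq
    convert hq using 5
    · rw [show ∀ j : ℕ, (k : ℤ) - u.1 + 1 + j + (u.1 - v.1) = k - v.1 + 1 + j from
        fun j => by ring]
    · rw [Prod.ext_iff, sub_eq_zero, Nat.cast_inj, eq_comm (a := v.2)]
  filter_upwards [hpos, h1, h2] with q hq0 hq1 hq2 γ
  refine design_lower_bound (Z := laggedRows Y k q.1 q.2)
    (V := fun u j => dualVar p A Sig Y u.1 u.2 ((k : ℤ) - u.1 + 1 + (j : ℕ)) q.2)
    hB hq0 (fun u hu => ?_) (fun u hu v hv => ?_) γ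
  · have := hq1 u hu
    rw [div_lt_iff₀ (by exact_mod_cast hq0)] at this
    rw [Fin.sum_univ_eq_sum_range (fun j : ℕ =>
      dualVar p A Sig Y u.1 u.2 ((k : ℤ) - u.1 + 1 + j) q.2 ^ 2)]
    exact this.le
  · have := hq2 u hu v hv
    simp only [laggedRows, Matrix.of_apply]
    rw [Fin.sum_univ_eq_sum_range (fun j : ℕ =>
      dualVar p A Sig Y u.1 u.2 ((k : ℤ) - u.1 + 1 + j) q.2 * Y ((k : ℤ) - v.1 + 1 + j) q.2 v.2)]
    exact this.le

/-- The errors are almost orthogonal to the lagged variables. -/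
lemma eventually_sum_innov_mul_sq_le (hY : IsGaussianVAR P p A Sig Y ε) (k : ℕ) (i : Fin d) {η : ℝ}
    (hη : 0 < η) :
    ∀ᶠ q in probFilter P, ∑ v ∈ laggedNodes d k,
      (∑ j : Fin q.1, innov p A Y ((k : ℤ) + 1 + (j : ℕ)) i q.2 * laggedRows Y k q.1 q.2 j v) ^ 2 ≤
        q.1 * (η * Real.log q.1) := by
  -- The sums have second moments of order `n`, so the extra factor `log n` forces convergence to
  -- zero. It is affordable because the penalty on superfluous parents is itself of order `log n`.
  have h1 : ∀ v ∈ laggedNodes d k, Tendsto (fun q : ℕ × Ω =>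
      (∑ j ∈ Finset.range q.1, innov p A Y ((k : ℤ) + 1 + j) i q.2 *
        Y ((k : ℤ) + 1 + j - v.1) q.2 v.2) / √(q.1 * Real.log q.1)) (probFilter P) (𝓝 0) := by
    intro v hv
    have hv1 : 1 ≤ v.1 := (Finset.mem_Icc.1 (Finset.mem_product.1 hv).1).1
    have h := hY.integral_sq_sum_innov_mul (x := fun t ω => Y (t - v.1) ω v.2)
      (fun t => measurable_past (by omega) v.2) (fun t => hY.memLp_eval _ v.2)
      (fun t => hY.integral_eval_sq _ v.2) i ((k : ℤ) + 1)
    set C := Sig i i * ∫ ω, Y 0 ω v.2 ^ 2 ∂P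
    refine tendsto_probFilter_zero_of_sq (f := fun n ω =>
      (∑ j ∈ Finset.range n, innov p A Y ((k : ℤ) + 1 + j) i ω *
        Y ((k : ℤ) + 1 + j - v.1) ω v.2) / √(n * Real.log n)) (b := fun n => C / Real.log n)
      ?_ ?_ ?_
    · intro n
      simp_rw [div_pow]
      exact (h n).1.div_const _
    · intro n
      simp_rw [div_pow]
      rw [integral_div, (h n).2, Real.sq_sqrt (mul_nonneg n.cast_nonneg (Real.log_natCast_nonneg n))]
      rcases Nat.eq_zero_or_pos n with rfl | hn
      · simp
      · have : (n : ℝ) ≠ 0 := by positivity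
        rw [mul_div_mul_left _ _ this]
    · exact tendsto_const_nhds.div_atTop (Real.tendsto_log_atTop.comp tendsto_natCast_atTop_atTop)
  have h2 := tendsto_finsetSum (laggedNodes d k) fun v hv => (h1 v hv).pow 2
  simp only [ne_eq, OfNat.ofNat_ne_zero, not_false_eq_true, zero_pow, Finset.sum_const_zero] at h2
  filter_upwards [h2.eventually (gt_mem_nhds hη),
    (tendsto_fst_probFilter P).eventually (eventually_ge_atTop 2)] with q hq hq2
  have hq2' : (2 : ℝ) ≤ q.1 := by exact_mod_cast hq2
  have hlog : 0 < Real.log q.1 := Real.log_pos (by linarith)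
  have hpos : 0 < q.1 * Real.log q.1 := by positivity
  simp_rw [div_pow, Real.sq_sqrt hpos.le] at hq
  rw [← Finset.sum_div, div_lt_iff₀ hpos] at hq
  refine le_trans (le_of_eq ?_) (hq.le.trans_eq (by ring))
  refine Finset.sum_congr rfl fun v _ => ?_
  simp only [laggedRows, Matrix.of_apply]
  rw [Fin.sum_univ_eq_sum_range (fun j : ℕ => innov p A Y ((k : ℤ) + 1 + j) i q.2 *
    Y ((k : ℤ) - v.1 + 1 + j) q.2 v.2)]
  congr 1
  refine Finset.sum_congr rfl fun j _ => ?_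
  rw [show (k : ℤ) - v.1 + 1 + j = k + 1 + j - v.1 by ring]

lemma eventually_sum_innov_sq (hY : IsGaussianVAR P p A Sig Y ε) (k : ℕ) (i : Fin d) :
    ∀ᶠ q in probFilter P,
      Sig i i / 2 * q.1 ≤ ∑ j : Fin q.1, innov p A Y ((k : ℤ) + 1 + (j : ℕ)) i q.2 ^ 2 ∧
      ∑ j : Fin q.1, innov p A Y ((k : ℤ) + 1 + (j : ℕ)) i q.2 ^ 2 ≤ 2 * Sig i i * q.1 := by
  have hσ : 0 < Sig i i := hY.posDef.diag_pos
  have h := (hY.hasMean_innov_mul_innov_self i i).lln ((k : ℤ) + 1)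
  filter_upwards [h.eventually (gt_mem_nhds (show Sig i i < 2 * Sig i i by linarith)),
    h.eventually (lt_mem_nhds (show Sig i i / 2 < Sig i i by linarith)),
    (tendsto_fst_probFilter P).eventually (eventually_gt_atTop 0)] with q h1 h2 h0
  have h0' : (0 : ℝ) < q.1 := by exact_mod_cast h0
  rw [div_lt_iff₀ h0'] at h1
  rw [lt_div_iff₀ h0'] at h2
  rw [Fin.sum_univ_eq_sum_range (fun j : ℕ => innov p A Y ((k : ℤ) + 1 + j) i q.2 ^ 2)]
  simp_rw [pow_two]
  exact ⟨h2.le, h1.le⟩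

/-- With probability tending to one, the set of nonzero autoregressive coefficients is the unique
maximiser of the score. -/
lemma eventually_fmplScore_lt (hY : IsGaussianVAR P p A Sig Y ε) {k : ℕ} {i : Fin d}
    (hk : ∀ l a, k < l → lagCoef p A l i a = 0) {mbTrue : Finset (ℕ × Fin d)}
    (hmbTrue : mbTrue = (laggedNodes d k).filter fun v => lagCoef p A v.1 i v.2 ≠ 0) :
    ∀ᶠ q in probFilter P, ∀ mb ∈ (laggedNodes d k).powerset, mb ≠ mbTrue →
      fmplScore q.1 mb.card (scatterDet (laggedRows Y k q.1 q.2) (insert (0, i) mb) /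
          scatterDet (laggedRows Y k q.1 q.2) mb) <
        fmplScore q.1 mbTrue.card (scatterDet (laggedRows Y k q.1 q.2) (insert (0, i) mbTrue) /
          scatterDet (laggedRows Y k q.1 q.2) mbTrue) := by
  obtain ⟨c, hc, hdesign⟩ := hY.exists_eventually_design k
  set S := laggedNodes d k with hS
  have hT : mbTrue ⊆ S := hmbTrue ▸ Finset.filter_subset _ _
  have hσ : 0 < Sig i i := hY.posDef.diag_pos
  set σ := Sig i i with hσdef
  -- With residuals at least `σ n / 4`, overfitting gains at most `n (η log n / c) / (σ n / 4) =
  -- (log n) / 4`, below the threshold `(log n) / 2` of `eventually_fmplScore_lt_of_lt`.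
  set η := c * σ / 16 with hηdef
  have hη : 0 < η := by positivity
  have hx : ((0, i) : ℕ × Fin d) ∉ S := by simp [hS, laggedNodes]
  have hlogo : ∀ μ : ℝ, 0 < μ → ∀ᶠ q : ℕ × Ω in probFilter P, Real.log q.1 ≤ μ * q.1 := by
    intro μ hμ
    have h1 : Tendsto (fun n : ℕ => Real.log n / n) atTop (𝓝 0) :=
      Real.isLittleO_log_id_atTop.tendsto_div_nhds_zero.comp tendsto_natCast_atTop_atTop
    filter_upwards [(h1.comp (tendsto_fst_probFilter P)).eventually (gt_mem_nhds hμ),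
      (tendsto_fst_probFilter P).eventually (eventually_gt_atTop 0)] with q hq h0
    have h0' : (0 : ℝ) < q.1 := by exact_mod_cast h0
    simp only [Function.comp_apply] at hq
    rw [div_lt_iff₀ h0'] at hq
    exact hq.le
  have hbounds : ∀ᶠ q in probFilter P, ∀ mb ⊆ S,
      scatterDet (laggedRows Y k q.1 q.2) (insert (0, i) mbTrue) /
        scatterDet (laggedRows Y k q.1 q.2) mbTrue ≤
          ∑ j : Fin q.1, innov p A Y ((k : ℤ) + 1 + (j : ℕ)) i q.2 ^ 2 ∧
      ∑ j : Fin q.1, innov p A Y ((k : ℤ) + 1 + (j : ℕ)) i q.2 ^ 2 - η * Real.log q.1 / c ≤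
        scatterDet (laggedRows Y k q.1 q.2) (insert (0, i) mb) /
          scatterDet (laggedRows Y k q.1 q.2) mb ∧
      ∀ v ∈ mbTrue, v ∉ mb →
        ∑ j : Fin q.1, innov p A Y ((k : ℤ) + 1 + (j : ℕ)) i q.2 ^ 2 +
          c * q.1 * lagCoef p A v.1 i v.2 ^ 2 / 2 - 2 * (η * Real.log q.1) / c ≤
        scatterDet (laggedRows Y k q.1 q.2) (insert (0, i) mb) /
          scatterDet (laggedRows Y k q.1 q.2) mb := by
    filter_upwards [hdesign, hY.eventually_sum_innov_mul_sq_le k i hη,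
      (tendsto_fst_probFilter P).eventually (eventually_gt_atTop 0)] with q h1 h2 h0 mb hmb
    refine residual_bounds (e := fun j => innov p A Y ((k : ℤ) + 1 + (j : ℕ)) i q.2)
      (β₀ := fun v => lagCoef p A v.1 i v.2) hc h0 hx hmb hT ?_ (fun j => ?_) h1 h2
    · intro v hv hv'
      by_contra hne
      exact hv' (by rw [hmbTrue]; exact Finset.mem_filter.2 ⟨hv, hne⟩)
    · simp only [laggedRows, Matrix.of_apply, Nat.cast_zero, sub_zero]
      rw [eval_eq_innov_add_sum_laggedNodes hk]
      congr 1
      refine Finset.sum_congr rfl fun v _ => ?_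
      rw [show (k : ℤ) + 1 + j - v.1 = k - v.1 + 1 + j by ring]
  -- The innovations have sum of squares at least `σ n / 2`, and the possible reduction by
  -- overfitting is only logarithmic.
  have hposR : ∀ᶠ q in probFilter P, ∀ mb ⊆ S, σ / 4 * q.1 ≤
      scatterDet (laggedRows Y k q.1 q.2) (insert (0, i) mb) /
          scatterDet (laggedRows Y k q.1 q.2) mb := by
    filter_upwards [hbounds, hY.eventually_sum_innov_sq k i, hlogo (σ / 4 * (c / η)) (by positivity)]
      with q h1 h2 h3 mb hmb
    have h4 := (h1 mb hmb).2.1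
    have h5 : η * Real.log q.1 / c ≤ σ / 4 * q.1 := by
      rw [div_le_iff₀ hc]
      calc η * Real.log q.1 ≤ η * (σ / 4 * (c / η) * q.1) := by gcongr
        _ = σ / 4 * q.1 * c := by field_simp
    linarith [h2.1]
  rw [Filter.eventually_all_finset]
  intro mb hmb
  rw [Finset.mem_powerset] at hmb
  by_cases hsub : mbTrue ⊆ mb
  · rcases eq_or_ne mb mbTrue with rfl | hne
    · exact Filter.Eventually.of_forall fun q h => absurd rfl h
    have hcard : mbTrue.card < mb.card :=
      Finset.card_lt_card (hsub.ssubset_of_ne hne.symm)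
    filter_upwards [hbounds, hposR, (tendsto_fst_probFilter P).eventually
      (eventually_fmplScore_lt_of_lt hcard),
      (tendsto_fst_probFilter P).eventually (eventually_gt_atTop 0)] with q h1 h2 h3 h0 _
    have h0' : (0 : ℝ) < q.1 := by exact_mod_cast h0
    have hσq : 0 < σ / 4 * q.1 := by positivity
    have hR := h2 mb hmb
    have hR' := h2 mbTrue hT
    have h4 := (h1 mb hmb).1
    have h5 := (h1 mb hmb).2.1
    set R := scatterDet (laggedRows Y k q.1 q.2) (insert (0, i) mb) /
          scatterDet (laggedRows Y k q.1 q.2) mb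
    set R' := scatterDet (laggedRows Y k q.1 q.2) (insert (0, i) mbTrue) /
          scatterDet (laggedRows Y k q.1 q.2) mbTrue
    have hR0 : 0 < R := hσq.trans_le hR
    have hR0' : 0 < R' := hσq.trans_le hR'
    refine h3 R R' hR0 hR0' ?_
    have hlog : 0 ≤ Real.log q.1 := Real.log_natCast_nonneg _
    have h6 : Real.log R' - Real.log R ≤ (R' - R) / R := by
      rw [← Real.log_div hR0'.ne' hR0.ne', sub_div, div_self hR0.ne']
      exact Real.log_le_sub_one_of_pos (by positivity)
    have h7 : (R' - R) / R ≤ (η * Real.log q.1 / c) / (σ / 4 * q.1) :=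
      div_le_div₀ (by positivity) (by linarith) hσq hR
    calc q.1 * (Real.log R' - Real.log R)
        ≤ q.1 * ((η * Real.log q.1 / c) / (σ / 4 * q.1)) := by
          gcongr
          exact h6.trans h7
      _ = Real.log q.1 / 4 := by
          rw [hηdef]
          field_simp
          ring
      _ ≤ Real.log q.1 / 2 := by linarith
  · obtain ⟨v, hv, hv'⟩ := Finset.not_subset.1 hsub
    have hβ : 0 < lagCoef p A v.1 i v.2 ^ 2 := by
      rw [hmbTrue] at hv
      have := (Finset.mem_filter.1 hv).2
      positivity
    set δ := lagCoef p A v.1 i v.2 ^ 2 with hδ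
    -- A missing parent adds `c n δ / 2` to the residual: half of it absorbs the logarithmic error,
    -- the other half is `x n`. Since the innovation sum of squares is at most `2 σ n`, the
    -- logarithms differ by at least `x / (2 σ + x)`.
    set x := c * δ / 4 with hxdef
    have hx0 : 0 < x := by positivity
    have hκ : 0 < x / (2 * σ + x) := by positivity
    filter_upwards [hbounds, hposR, (tendsto_fst_probFilter P).eventually
      (eventually_fmplScore_lt_of_log_le mb.card mbTrue.card hκ),
      hY.eventually_sum_innov_sq k i, hlogo (x * (c / (2 * η))) (by positivity),
      (tendsto_fst_probFilter P).eventually (eventually_gt_atTop 0)] with q h1 h2 h3 h6 h7 h0 _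
    have h0' : (0 : ℝ) < q.1 := by exact_mod_cast h0
    have hσq : 0 < σ / 4 * q.1 := by positivity
    have hR := h2 mb hmb
    have hR' := h2 mbTrue hT
    have h4 := (h1 mb hmb).1
    have h5 := (h1 mb hmb).2.2 v hv hv'
    set R := scatterDet (laggedRows Y k q.1 q.2) (insert (0, i) mb) /
          scatterDet (laggedRows Y k q.1 q.2) mb
    set R' := scatterDet (laggedRows Y k q.1 q.2) (insert (0, i) mbTrue) /
          scatterDet (laggedRows Y k q.1 q.2) mbTrue
    set E := ∑ j : Fin q.1, innov p A Y ((k : ℤ) + 1 + (j : ℕ)) i q.2 ^ 2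
    have hR0 : 0 < R := hσq.trans_le hR
    have hR0' : 0 < R' := hσq.trans_le hR'
    have hE : 0 < E := hR0'.trans_le h4
    refine h3 R R' hR0 hR0' ?_
    have h8 : 2 * (η * Real.log q.1) / c ≤ x * q.1 := by
      rw [div_le_iff₀ hc]
      calc 2 * (η * Real.log q.1) ≤ 2 * (η * (x * (c / (2 * η)) * q.1)) := by gcongr
        _ = x * q.1 * c := by field_simp
    have h9 : E + x * q.1 ≤ R := by
      have : c * q.1 * δ / 2 = 2 * (x * q.1) := by rw [hxdef]; ring
      linarith
    have hx1 : 0 < x * q.1 := by positivity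
    have h10 : Real.log E - Real.log (E + x * q.1) ≤ -(x * q.1 / (E + x * q.1)) := by
      rw [← Real.log_div hE.ne' (by positivity)]
      refine (Real.log_le_sub_one_of_pos (by positivity)).trans_eq ?_
      field_simp
      ring
    have h11 : x / (2 * σ + x) ≤ x * q.1 / (E + x * q.1) := by
      rw [div_le_div_iff₀ (by positivity) (by positivity)]
      have : x * E ≤ x * (2 * σ * q.1) := mul_le_mul_of_nonneg_left h6.2 hx0.le
      nlinarith
    have h12 := Real.log_le_log hR0' h4
    have h13 := Real.log_le_log (by positivity) h9
    linarith

end IsGaussianVAR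

end PLVAR

/-! ### Consistency of the maximiser. -/

theorem theorem1 {Ω : Type*} [MeasurableSpace Ω] (P : Measure Ω) [IsProbabilityMeasure P]
    {d p : ℕ} (A : ℕ → Matrix (Fin d) (Fin d) ℝ) (Sig : Matrix (Fin d) (Fin d) ℝ)
    (Y ε : ℤ → Ω → EuclideanSpace ℝ (Fin d)) (hY : PLVAR.IsGaussianVAR P p A Sig Y ε)
    (k : ℕ) (t : ℤ) (i : Fin d)
    (hk : PLVAR.temporalMarkovBlanket P Y t i ⊆ (PLVAR.laggedNodes d k : Set (ℕ × Fin d)) ∨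
      PLVAR.trueLagLength p A ≤ k) :
    Tendsto
      (fun N : ℕ => P {ω | ∀ mb : Finset (ℕ × Fin d),
        mb ∈ PLVAR.argmaxLocalFMPL (fun s => Y s ω) N k i ↔
          (mb : Set (ℕ × Fin d)) = PLVAR.temporalMarkovBlanket P Y t i})
      atTop (𝓝 1) := by
  have hk' : ∀ l a, k < l → PLVAR.lagCoef p A l i a = 0 := by
    intro l a hl
    rcases hk with hk | hk
    · by_contra hne
      have h1 := hk ((hY.mem_temporalMarkovBlanket_iff t i (l, a)).2 hne)
      rw [Finset.mem_coe, PLVAR.laggedNodes, Finset.mem_product, Finset.mem_Icc] at h1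
      have := h1.1.2
      simp only at this
      omega
    · rw [PLVAR.lagCoef_eq_zero_of_trueLagLength_le hk l hl, Matrix.zero_apply]
  obtain ⟨T, hT⟩ : ∃ T, T = (PLVAR.laggedNodes d k).filter
    fun v => PLVAR.lagCoef p A v.1 i v.2 ≠ 0 := ⟨_, rfl⟩
  have hTS : T ⊆ PLVAR.laggedNodes d k := hT ▸ Finset.filter_subset _ _
  have hTb : (T : Set (ℕ × Fin d)) = PLVAR.temporalMarkovBlanket P Y t i :=
    hT ▸ PLVAR.coe_filter_lagCoef_eq_temporalMarkovBlanket hY t i hk'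
  -- The comparison is indexed by the number of rows, hence the composition with `N ↦ N - k`. From
  -- `N ≥ k` on, the truncated subtraction agrees with the real one in the score.
  have h := (PLVAR.tendsto_measure_one_of_eventually
    (hY.eventually_fmplScore_lt hk' hT)).comp (tendsto_sub_atTop_nat k)
  refine tendsto_of_tendsto_of_tendsto_of_le_of_le' h tendsto_const_nhds ?_
    (Eventually.of_forall fun N => prob_le_one)
  filter_upwards [eventually_ge_atTop k] with N hN
  refine measure_mono fun ω hω mb => ?_
  have hscore : ∀ mb : Finset (ℕ × Fin d), PLVAR.localFMPL (fun s => Y s ω) N k i mb =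
      PLVAR.fmplScore (N - k : ℕ) mb.card
        (PLVAR.scatterDet (PLVAR.laggedRows Y k (N - k) ω) (insert (0, i) mb) /
          PLVAR.scatterDet (PLVAR.laggedRows Y k (N - k) ω) mb) := by
    intro mb
    rw [Nat.cast_sub hN]
    rfl
  have hlt : ∀ mb ⊆ PLVAR.laggedNodes d k, mb ≠ T →
      PLVAR.localFMPL (fun s => Y s ω) N k i mb < PLVAR.localFMPL (fun s => Y s ω) N k i T := by
    intro mb hmb hne
    rw [hscore, hscore]
    exact hω mb (Finset.mem_powerset.2 hmb) hne
  rw [← hTb, Finset.coe_inj]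
  refine ⟨fun hmb => ?_, ?_⟩
  · by_contra hne
    exact (hlt mb hmb.1 hne).not_ge (hmb.2 T hTS)
  · rintro rfl
    refine ⟨hTS, fun mb' hmb' => ?_⟩
    rcases eq_or_ne mb' mb with rfl | hne
    · exact le_rfl
    · exact (hlt mb' hmb' hne).le
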